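/- Let $P,R:\mathbb{R}\to\mathbb{R}$ be $C^2$ and $2\pi$-periodic, and consider, for $N\ge 1$, the Winfree model $$\dot x_i=\omega_i-\kappa\,\frac1N\sum_{j=1}^N P(x_j)R(x_i),\qquad 1\le i\le N,$$ with phases $x_i(t)\in\mathbb{R}$. Let $$\kappa_*:=\sup\{\kappa>0 : 1-\kappa P(x)R(x)>0\ \text{ for all } x\in\mathbb{R}\}\in(0,+\infty],$$ and assume that $$\int_0^{2\pi}\frac{P(s)R'(s)}{1-\kappa P(s)R(s)}\,ds>0\qquad\text{for every }\kappa\in(0,\kappa_*).$$ Then there is an open set $U\subset(0,1)\times(0,\kappa_*)$ of parameters $(\gamma,\kappa)$, independent of $N$ and of the frequencies, whose closure in $\mathbb{R}^2$ contains $\{(0,\kappa): \kappa\in\mathbb{R},\ 0\le\kappa\le\kappa_*\}$, with the following property. For every $(\gamma,\kappa)\in U$ there are a $C^2$, $2\pi$-periodic function $\Delta_{\gamma,\kappa}:\mathbb{R}\to(0,1)$ and a constant $M_{\gamma,\kappa}$, both independent of $N$ and of the frequencies, such that for every $N\ge1$ and every choice of frequencies $\omega_1,\dots,\omega_N\in(1-\gamma,1+\gamma)$: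 1. The set $$C^N_{\gamma,\kappa}:=\Big\{X\in\mathbb{R}^N : \max_{i,j}|x_j-x_i|<\Delta_{\gamma,\kappa}\Big(\frac1N\sum_{i=1}^N x_i\Big)\Big\}$$ is open and invariant under the forward flow of the model: from each of its points a solution exists for all $t\ge0$, and every solution starting in it stays in it for all $t\ge 0$. In particular, every solution that starts in $C^N_{\gamma,\kappa}$ is synchronized, i.e. $\max_{i,j}|x_i(t)-x_j(t)|$ is bounded uniformly in $t\ge0$. 2. There are a solution $(x_i^*)_{i=1}^N$ with initial condition in $C^N_{\gamma,\kappa}$, a common frequency $\Omega>0$ (which may depend on $N$ and on the frequencies), and $C^2$ functions $\Psi_i$, periodic of period $2\pi/\Omega$, with $|\Psi_i|\le M_{\gamma,\kappa}$, such that $x_i^*(t)=\Omega t+\Psi_i(t)$ for all $i$ and all $t\ge0$. This solution is synchronized, so it is periodically locked to the frequency $\Omega$. -/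

import Mathlib

namespace Winfree

/-- The critical coupling `κ_*`: the supremum, in the extended reals, of all `κ > 0` such that
`1 - κ P(x) R(x) > 0` for every `x`. It is `⊤` when `P R ≤ 0` everywhere. -/
noncomputable def kappaStar (P R : ℝ → ℝ) : EReal :=
  sSup {k : EReal | ∃ κ : ℝ, k = (κ : EReal) ∧ 0 < κ ∧ ∀ x : ℝ, 0 < 1 - κ * P x * R x}

/-- The right-hand side of the Winfree model. -/
noncomputable def field (P R : ℝ → ℝ) (κ : ℝ) {N : ℕ} (ω : Fin N → ℝ) (X : Fin N → ℝ) :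
    Fin N → ℝ :=
  fun i => ω i - κ * ((1 / (N : ℝ)) * ∑ j, P (X j) * R (X i))

/-- `x` solves the Winfree model for all times `t ≥ 0`
(the derivative at `t = 0` is one-sided, and values of `x` at negative times play no role). -/
def IsSolution (P R : ℝ → ℝ) (κ : ℝ) {N : ℕ} (ω : Fin N → ℝ) (x : ℝ → Fin N → ℝ) : Prop :=
  ∀ t : ℝ, 0 ≤ t → HasDerivWithinAt x (field P R κ ω (x t)) (Set.Ici 0) t

/-- The mean phase of a state. -/
noncomputable def mean {N : ℕ} (X : Fin N → ℝ) : ℝ := (1 / (N : ℝ)) * ∑ i, X i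

/-- The states `X` with `max_{i,j} |X_j - X_i| < Δ (mean X)`. -/
def tube (N : ℕ) (Δ : ℝ → ℝ) : Set (Fin N → ℝ) :=
  {X | ∀ i j, |X j - X i| < Δ (mean X)}

/-- `C` is invariant under the (forward) flow of the Winfree model: from each point of `C` a
solution exists for all times `t ≥ 0`, and every solution starting at that point stays in `C`. -/
def IsFlowInvariant (P R : ℝ → ℝ) (κ : ℝ) {N : ℕ} (ω : Fin N → ℝ) (C : Set (Fin N → ℝ)) : Prop :=
  ∀ X₀ ∈ C, (∃ x : ℝ → Fin N → ℝ, IsSolution P R κ ω x ∧ x 0 = X₀) ∧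
    ∀ x : ℝ → Fin N → ℝ, IsSolution P R κ ω x → x 0 = X₀ → ∀ t : ℝ, 0 ≤ t → x t ∈ C

/-- The mutual distances of the (lifted) phases are bounded uniformly in time `t ≥ 0`. -/
def IsSynchronized {N : ℕ} (x : ℝ → Fin N → ℝ) : Prop :=
  ∃ B : ℝ, ∀ t : ℝ, 0 ≤ t → ∀ i j, |x t i - x t j| ≤ B

end Winfree

/-!
# Invariant tubes and locked solutions of the Winfree model

Fix `κ₀ ∈ (0, κ_*)`. Near the diagonal the mean phase `s` moves with velocity close to
`f(s) = 1 - κ₀ P(s) R(s) > 0`, and a phase difference `d` satisfies `d' ≈ -κ₀ P(s) R'(s) d`. Per unit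
of mean phase, differences are therefore contracted at rate `a = κ₀ P R' / f`, which may change sign
but whose average `m` over a period is positive by the integral hypothesis. A periodic weight `w`
with `w' = (m - a) w` (`exists_weight`) turns this into contraction at the constant rate `m`. All
errors caused by the nonlinearity, by `|κ - κ₀| < ε` and by a frequency spread `γ < ε²` have relative
order `ε` in a tube of width `ε w`, so they are dominated by `m` when `ε` is small; the rectangles
`0 < γ < ε²`, `|κ - κ₀| < ε` make up the open parameter region.

*Invariance.* With `Δ = ε w` the function `X i - X j - Δ(mean X)` has negative derivative wherever it
vanishes on the closed tube (`IsSmall.deriv_neg_of_boundary`), and a first-exit argument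
(`forall_neg_of_barrier`) gives forward invariance.

*Locked solution.* Since the mean phase is increasing in the tube, it can serve as time. The
deviations `y = w u` from the mean phase then solve a `2π`-periodic equation `u' = -m u + h(s, u)`
on the vectors of mean zero, where `h` is small with Lipschitz constant of order `ε`. Inverting
`d/ds + m` on periodic functions and applying Banach's fixed point theorem
(`exists_periodic_solution`) yields a periodic `u`; this replaces a Poincaré map and Brouwer's
theorem. The mean phase along this orbit solves a scalar equation on the circle, hence rotates
with a definite period (`exists_rotation`), and the resulting solution of the model is `Ω t` plus
periodic functions.
-/

namespace Winfree

open Set Filter Topology MeasureTheory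

/-! ### Continuous periodic functions -/

lemma exists_abs_le_of_periodic {f : ℝ → ℝ} {T : ℝ} (hf : Continuous f)
    (hper : Function.Periodic f T) (hT : T ≠ 0) : ∃ B, ∀ x, |f x| ≤ B := by
  obtain ⟨B, hB⟩ := (hper.isBounded_of_continuous hT hf).exists_norm_le
  exact ⟨B, fun x => hB _ (mem_range_self x)⟩

lemma exists_pos_le_of_periodic {f : ℝ → ℝ} {T : ℝ} (hf : Continuous f)
    (hper : Function.Periodic f T) (hT : T ≠ 0) (hpos : ∀ x, 0 < f x) :
    ∃ c, 0 < c ∧ ∀ x, c ≤ f x := by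
  obtain ⟨_, ⟨x, rfl⟩, hx⟩ :=
    (hper.compact_of_continuous hT hf).exists_isLeast (range_nonempty f)
  exact ⟨f x, hpos x, fun y => hx (mem_range_self y)⟩

lemma periodic_deriv {f : ℝ → ℝ} {T : ℝ} (hper : Function.Periodic f T) :
    Function.Periodic (deriv f) T := fun x => by
  rw [← deriv_comp_add_const, show (fun x => f (x + T)) = f from funext hper]

/-! ### Global solutions and barriers -/

/-- A bounded, globally Lipschitz vector field on a Banach space has global solutions. -/
lemma exists_global_solution {E : Type*} [NormedAddCommGroup E] [NormedSpace ℝ E]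
    [CompleteSpace E] {f : E → E} {K : NNReal} {L : ℝ} (hK : LipschitzWith K f)
    (hL : ∀ x, ‖f x‖ ≤ L) (x₀ : E) :
    ∃ x : ℝ → E, x 0 = x₀ ∧ ∀ t, HasDerivAt x (f (x t)) t := by
  have hL0 : 0 ≤ L := (norm_nonneg _).trans (hL x₀)
  have key : ∀ a : ℝ, 0 < a → ∃ x : ℝ → E, x 0 = x₀ ∧
      ∀ t ∈ Ioo (-a) a, HasDerivAt x (f (x t)) t := by
    intro a ha
    -- On a ball of radius `L a` the solution cannot escape before time `a`.
    have hPL : IsPicardLindelof (fun _ => f) (⟨0, by constructor <;> linarith⟩ : Icc (-a) a)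
        x₀ (⟨L * a, by positivity⟩ : NNReal) 0 ⟨L, hL0⟩ K :=
      IsPicardLindelof.of_time_independent (fun x _ => hL x) hK.lipschitzOnWith
        (show L * max (a - 0) (0 - -a) ≤ L * a - 0 by simp)
    obtain ⟨x, hx0, hx⟩ := hPL.exists_eq_forall_mem_Icc_hasDerivWithinAt₀
    exact ⟨x, hx0, fun t ht => (hx t (Ioo_subset_Icc_self ht)).hasDerivAt (Icc_mem_nhds ht.1 ht.2)⟩
  choose! x hx0 hx using key
  have agree : ∀ a b t : ℝ, 0 < a → a ≤ b → t ∈ Ioo (-a) a → x a t = x b t := by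
    intro a b t ha hab ht
    refine ODE_solution_unique_of_mem_Ioo (v := fun _ => f) (s := fun _ => univ) (t₀ := 0)
      (fun _ _ => hK.lipschitzOnWith) ⟨by linarith, ha⟩ (fun t ht => ⟨hx a ha t ht, trivial⟩)
      (fun t ht => ⟨hx b (by linarith) t ⟨by linarith [ht.1], by linarith [ht.2]⟩, trivial⟩)
      (by rw [hx0 a ha, hx0 b (by linarith)]) ht
  refine ⟨fun t => x (|t| + 1) t, by simp [hx0], fun t => ?_⟩
  have hpos : 0 < |t| + 2 := by positivity
  have hmem : t ∈ Ioo (-(|t| + 2)) (|t| + 2) :=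
    ⟨by linarith [neg_abs_le t], by linarith [le_abs_self t]⟩
  have hmem' : t ∈ Ioo (-(|t| + 1)) (|t| + 1) :=
    ⟨by linarith [neg_abs_le t], by linarith [le_abs_self t]⟩
  have h := hx _ hpos t hmem
  rw [← agree (|t| + 1) (|t| + 2) t (by positivity) (by linarith) hmem'] at h
  refine h.congr_of_eventuallyEq ?_
  filter_upwards [Ioo_mem_nhds hmem'.1 hmem'.2] with s hs
  have hs' : |s| < |t| + 1 := abs_lt.2 hs
  exact agree _ _ _ (by positivity) (by linarith)
    ⟨by linarith [neg_abs_le s], by linarith [le_abs_self s]⟩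

/-- First-exit argument: finitely many functions that start negative stay negative if each of
them has negative derivative whenever it vanishes while all the others are nonpositive. -/
lemma forall_neg_of_barrier {ι : Type*} [Finite ι] {g g' : ι → ℝ → ℝ}
    (hg : ∀ k t, 0 ≤ t → HasDerivWithinAt (g k) (g' k t) (Ici 0) t)
    (h0 : ∀ k, g k 0 < 0)
    (hb : ∀ t, 0 ≤ t → (∀ k, g k t ≤ 0) → ∀ k, g k t = 0 → g' k t < 0) :
    ∀ t, 0 ≤ t → ∀ k, g k t < 0 := by
  intro t ht k
  by_contra! hk
  have hcont : ∀ k, ContinuousOn (g k) (Ici 0) := fun k t ht => (hg k t ht).continuousWithinAt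
  set S : Set ℝ := ⋃ k, Ici 0 ∩ g k ⁻¹' Ici 0 with hS
  have hSc : IsClosed S :=
    isClosed_iUnion_of_finite fun k => (hcont k).preimage_isClosed_of_isClosed isClosed_Ici isClosed_Ici
  have hSne : S.Nonempty := ⟨t, mem_iUnion.2 ⟨k, ht, hk⟩⟩
  have hSbdd : BddBelow S := ⟨0, fun s hs => by
    obtain ⟨_, hs, _⟩ := mem_iUnion.1 hs; exact hs⟩
  set τ := sInf S
  have hτS : τ ∈ S := hSc.csInf_mem hSne hSbdd
  have hbefore : ∀ s, 0 ≤ s → s < τ → ∀ k, g k s < 0 := by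
    intro s hs hsτ k
    by_contra! h
    exact absurd (csInf_le hSbdd (mem_iUnion.2 ⟨k, hs, h⟩)) (not_le.2 hsτ)
  obtain ⟨j, hτ0 : 0 ≤ τ, hj : 0 ≤ g j τ⟩ := mem_iUnion.1 hτS
  have hτpos : 0 < τ := hτ0.lt_of_ne fun h => by
    rw [← h] at hj; exact absurd (h0 j) (not_lt.2 hj)
  have hd : ∀ k, HasDerivAt (g k) (g' k τ) τ := fun k => (hg k τ hτ0).hasDerivAt (Ici_mem_nhds hτpos)
  have hleft : ∀ᶠ s in 𝓝[<] τ, s ∈ Ioo 0 τ := Ioo_mem_nhdsLT hτpos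
  have hle : ∀ k, g k τ ≤ 0 := fun k =>
    le_of_tendsto ((hd k).continuousAt.tendsto.mono_left nhdsWithin_le_nhds)
      (hleft.mono fun s hs => (hbefore s hs.1.le hs.2 k).le)
  have hj0 : g j τ = 0 := le_antisymm (hle j) hj
  have hneg := hb τ hτ0 hle j hj0
  -- To the left of `τ` the slopes of `g j` are positive, so the derivative is nonnegative.
  have hslope := (hasDerivAt_iff_tendsto_slope.1 (hd j)).mono_left
    (nhdsWithin_mono τ (show Iio τ ⊆ {τ}ᶜ from fun s hs => ne_of_lt hs))
  refine absurd (ge_of_tendsto hslope (hleft.mono fun s hs => ?_)) (not_le.2 hneg)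
  rw [slope_def_field, hj0]
  exact (div_pos_of_neg_of_neg (by linarith [hbefore s hs.1.le hs.2 j]) (by linarith [hs.2])).le

/-! ### Periodic solutions of weakly nonlinear equations -/

section Green

variable {E : Type*} [NormedAddCommGroup E] [NormedSpace ℝ E]

/-- The Green operator of `u' = -m u + g` on `T`-periodic functions:
`u(s) = (e^{mT} - 1)⁻¹ ∫_s^{s+T} e^{m(σ-s)} g(σ) dσ`. -/
noncomputable def green (m T : ℝ) (g : ℝ → E) (s : ℝ) : E :=
  (Real.exp (m * T) - 1)⁻¹ • ∫ σ in s..(s + T), Real.exp (m * (σ - s)) • g σ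

lemma green_periodic {m T : ℝ} {g : ℝ → E} (hper : Function.Periodic g T) :
    Function.Periodic (green m T g) T := fun s => by
  unfold green
  congr 1
  rw [← intervalIntegral.integral_comp_add_right _ T]
  refine intervalIntegral.integral_congr fun σ _ => ?_
  simp only [hper σ]
  congr 3; ring

lemma green_sub {m T : ℝ} {g₁ g₂ : ℝ → E} (h₁ : Continuous g₁) (h₂ : Continuous g₂) (s : ℝ) :
    green m T g₁ s - green m T g₂ s = green m T (fun σ => g₁ σ - g₂ σ) s := by
  unfold green
  rw [← smul_sub, ← intervalIntegral.integral_sub]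
  · simp only [smul_sub]
  · exact (by fun_prop : Continuous _).intervalIntegrable _ _
  · exact (by fun_prop : Continuous _).intervalIntegrable _ _

lemma norm_green_le {m T C : ℝ} (hm : 0 < m) (hT : 0 < T) {g : ℝ → E} (hC : ∀ s, ‖g s‖ ≤ C)
    (s : ℝ) : ‖green m T g s‖ ≤ C / m := by
  have hpos : 0 < Real.exp (m * T) - 1 := by
    have := Real.add_one_lt_exp (mul_pos hm hT).ne'
    have := mul_pos hm hT
    linarith
  have hint : ∫ σ in s..(s + T), Real.exp (m * (σ - s)) * C = (Real.exp (m * T) - 1) * (C / m) := by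
    have : ∀ σ ∈ uIcc s (s + T), HasDerivAt (fun σ => Real.exp (m * (σ - s)) * (C / m))
        (Real.exp (m * (σ - s)) * C) σ := fun σ _ => by
      have h1 : HasDerivAt (fun σ => m * (σ - s)) m σ := by
        simpa using ((hasDerivAt_id σ).sub_const s).const_mul m
      exact (h1.exp.mul_const (C / m)).congr_deriv (by field_simp)
    rw [intervalIntegral.integral_eq_sub_of_hasDerivAt this
      ((by fun_prop : Continuous _).intervalIntegrable _ _)]
    simp; ring
  unfold green
  rw [norm_smul, norm_inv, Real.norm_of_nonneg hpos.le, inv_mul_le_iff₀ hpos, ← hint]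
  refine intervalIntegral.norm_integral_le_of_norm_le (by linarith) (Eventually.of_forall fun σ _ => ?_)
    ((by fun_prop : Continuous _).intervalIntegrable _ _)
  rw [norm_smul, Real.norm_of_nonneg (Real.exp_nonneg _)]
  gcongr
  exact hC σ

lemma hasDerivAt_green [CompleteSpace E] {m T : ℝ} (hm : 0 < m) (hT : 0 < T) {g : ℝ → E}
    (hg : Continuous g) (hper : Function.Periodic g T) (s : ℝ) :
    HasDerivAt (green m T g) (-(m • green m T g s) + g s) s := by
  have hpos : Real.exp (m * T) - 1 ≠ 0 := by
    have := Real.add_one_lt_exp (mul_pos hm hT).ne'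
    have := mul_pos hm hT
    linarith
  set k : ℝ → E := fun σ => Real.exp (m * σ) • g σ with hk
  have hkc : Continuous k := by fun_prop
  have hint : ∀ a b, IntervalIntegrable k volume a b := fun a b => hkc.intervalIntegrable a b
  have hform : green m T g = fun s => (Real.exp (m * T) - 1)⁻¹ • Real.exp (-(m * s)) •
      ((∫ σ in (0:ℝ)..(s + T), k σ) - ∫ σ in (0:ℝ)..s, k σ) := by
    funext s
    rw [intervalIntegral.integral_interval_sub_left (hint _ _) (hint _ _),
      ← intervalIntegral.integral_smul]
    unfold green
    congr 1
    refine intervalIntegral.integral_congr fun σ _ => ?_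
    simp only [hk, smul_smul, ← Real.exp_add]
    congr 2; ring
  have h1 : HasDerivAt (fun s => ∫ σ in (0:ℝ)..(s + T), k σ) (k (s + T)) s :=
    HasDerivAt.comp_add_const s T (hkc.integral_hasStrictDerivAt 0 (s + T)).hasDerivAt
  have h2 : HasDerivAt (fun s => ∫ σ in (0:ℝ)..s, k σ) (k s) s :=
    (hkc.integral_hasStrictDerivAt 0 s).hasDerivAt
  have h3 : HasDerivAt (fun s => Real.exp (-(m * s))) (-(m * Real.exp (-(m * s)))) s := by
    have : HasDerivAt (fun s => -(m * s)) (-m) s := by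
      simpa using ((hasDerivAt_id s).const_mul (-m))
    exact this.exp.congr_deriv (by ring)
  have h4 := (h3.smul (h1.sub h2)).const_smul (Real.exp (m * T) - 1)⁻¹
  rw [hform]
  refine h4.congr_deriv ?_
  have e1 : k (s + T) - k s = ((Real.exp (m * T) - 1) * Real.exp (m * s)) • g s := by
    simp only [hk, hper s, ← sub_smul]
    congr 1
    rw [mul_add, Real.exp_add]; ring
  simp only [Pi.sub_apply, e1, smul_add, smul_smul, neg_smul, smul_neg]
  rw [add_comm]
  congr 1
  · congr 2; ring
  · rw [show (Real.exp (m * T) - 1)⁻¹ * (Real.exp (-(m * s)) *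
      ((Real.exp (m * T) - 1) * Real.exp (m * s))) = (Real.exp (-(m * s)) * Real.exp (m * s)) *
        ((Real.exp (m * T) - 1)⁻¹ * (Real.exp (m * T) - 1)) by ring, ← Real.exp_add,
      inv_mul_cancel₀ hpos]
    simp

open BoundedContinuousFunction Metric in
/-- If the nonlinearity `h` is small and has small Lipschitz constant compared with the linear
decay rate `m`, then `u' = -m u + h(s, u)` has a `T`-periodic solution of size at most `ρ`. -/
lemma exists_periodic_solution [CompleteSpace E] {T m ρ L : ℝ} (hT : 0 < T) (hm : 0 < m)
    (hρ : 0 ≤ ρ) {h : ℝ → E → E}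
    (hcont : ContinuousOn (Function.uncurry h) (univ ×ˢ closedBall 0 ρ))
    (hper : ∀ s u, h (s + T) u = h s u)
    (hbd : ∀ s, ∀ u ∈ closedBall (0 : E) ρ, ‖h s u‖ ≤ m * ρ)
    (hlip : ∀ s, ∀ u ∈ closedBall (0 : E) ρ, ∀ v ∈ closedBall (0 : E) ρ,
      ‖h s u - h s v‖ ≤ L * ‖u - v‖) (hL0 : 0 ≤ L) (hL : L < m) :
    ∃ u : ℝ → E, Function.Periodic u T ∧ (∀ s, ‖u s‖ ≤ ρ) ∧
      ∀ s, HasDerivAt u (-(m • u s) + h s (u s)) s := by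
  set X : Set (ℝ →ᵇ E) := {u | ∀ s, u (s + T) = u s ∧ ‖u s‖ ≤ ρ} with hX
  have hXc : IsClosed X := by
    simp only [hX, ofPred_forall]
    refine isClosed_iInter fun s => ?_
    have ev : ∀ s, Continuous fun u : ℝ →ᵇ E => u s := fun s => continuous_eval_const s
    exact (isClosed_eq (ev _) (ev _)).inter (isClosed_le (ev s).norm continuous_const)
  have : CompleteSpace X := hXc.completeSpace_coe
  have : Nonempty X := ⟨⟨0, fun s => by simpa using hρ⟩⟩
  have hball : ∀ (u : X) s, u.1 s ∈ closedBall (0 : E) ρ := fun u s => by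
    simpa using (u.2 s).2
  have hg : ∀ u : X, Continuous fun s => h s (u.1 s) := fun u =>
    hcont.comp_continuous (continuous_id.prodMk u.1.continuous) fun s => ⟨trivial, hball u s⟩
  have hgper : ∀ u : X, Function.Periodic (fun s => h s (u.1 s)) T := fun u s => by
    simp only [(u.2 s).1, hper]
  have hbound : ∀ (u : X) s, ‖green m T (fun s => h s (u.1 s)) s‖ ≤ ρ := fun u s => by
    have := norm_green_le hm hT (g := fun s => h s (u.1 s)) (fun s => hbd s _ (hball u s)) s
    rwa [mul_div_cancel_left₀ _ hm.ne'] at this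
  let Φ : X → X := fun u => ⟨BoundedContinuousFunction.ofNormedAddCommGroup
    (green m T fun s => h s (u.1 s))
    (continuous_iff_continuousAt.2 fun s =>
      (hasDerivAt_green hm hT (hg u) (hgper u) s).continuousAt) ρ (hbound u),
    fun s => ⟨green_periodic (hgper u) s, hbound u s⟩⟩
  have hΦ : ContractingWith (L / m).toNNReal Φ := by
    refine ⟨Real.toNNReal_lt_one.2 ((div_lt_one hm).2 hL),
      LipschitzWith.of_dist_le_mul fun u v => ?_⟩
    rw [Real.coe_toNNReal _ (by positivity)]
    change dist (Φ u).1 (Φ v).1 ≤ L / m * dist u.1 v.1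
    refine (dist_le (by positivity)).2 fun s => ?_
    rw [dist_eq_norm]
    change ‖green m T (fun s => h s (u.1 s)) s - green m T (fun s => h s (v.1 s)) s‖ ≤ _
    rw [green_sub (hg u) (hg v), div_mul_eq_mul_div]
    refine norm_green_le hm hT (fun σ => ?_) s
    refine (hlip σ _ (hball u σ) _ (hball v σ)).trans ?_
    gcongr
    rw [← dist_eq_norm]
    exact dist_coe_le_dist σ
  obtain ⟨u, hu⟩ : ∃ u, Φ u = u := ⟨_, hΦ.fixedPoint_isFixedPt⟩
  have hfun : (u.1 : ℝ → E) = green m T fun s => h s (u.1 s) :=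
    (congrArg (fun v : X => (v.1 : ℝ → E)) hu).symm
  refine ⟨u.1, fun s => (u.2 s).1, fun s => (u.2 s).2, fun s => ?_⟩
  have := hasDerivAt_green hm hT (hg u) (hgper u) s
  rwa [← hfun] at this

end Green

/-! ### Scalar equations on the circle -/

/-- The scalar equation `μ' = h(μ)` with `h` positive and `S`-periodic is solved by inverting
`s ↦ ∫₀ˢ 1/h`; the solution advances by `S` in a fixed time `T`. -/
lemma exists_rotation {h : ℝ → ℝ} {S : ℝ} (hS : 0 < S) (hc : Continuous h)
    (hper : Function.Periodic h S) (hpos : ∀ s, 0 < h s) :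
    ∃ (μ : ℝ → ℝ) (T : ℝ), 0 < T ∧ μ 0 = 0 ∧ (∀ t, HasDerivAt μ (h (μ t)) t) ∧
      (∀ t, μ (t + T) = μ t + S) ∧ ∀ t, |μ t - S / T * t| ≤ S := by
  set τ : ℝ → ℝ := fun s => ∫ σ in (0:ℝ)..s, (h σ)⁻¹ with hτ
  have hic : Continuous fun s => (h s)⁻¹ := hc.inv₀ fun s => (hpos s).ne'
  have hd : ∀ s, HasDerivAt τ (h s)⁻¹ s := fun s =>
    (hic.integral_hasStrictDerivAt 0 s).hasDerivAt
  have hmono : StrictMono τ := strictMono_of_hasDerivAt_pos hd fun s => inv_pos.2 (hpos s)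
  have hτ0 : τ 0 = 0 := by simp [hτ]
  have hT : 0 < τ S := hτ0 ▸ hmono hS
  have hadd : ∀ s, τ (s + S) = τ s + τ S := fun s => by
    have hp : Function.Periodic (fun s => (h s)⁻¹) S := fun s => by simp only [hper s]
    have := hp.intervalIntegral_add_eq s 0
    rw [zero_add] at this
    simp only [hτ]
    rw [← this, intervalIntegral.integral_add_adjacent_intervals] <;>
      exact hic.intervalIntegrable _ _
  have hcont : Continuous τ := continuous_iff_continuousAt.2 fun s => (hd s).continuousAt
  have hsurj : Function.Surjective τ := by
    obtain ⟨C, hC0, hC⟩ := exists_pos_le_of_periodic hic (fun s => by simp only [hper s]) hS.ne'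
      fun s => inv_pos.2 (hpos s)
    have hmono' : Monotone fun s => τ s - C * s := monotone_of_hasDerivAt_nonneg
      (f' := fun s => (h s)⁻¹ - C * 1) (fun s => (hd s).sub ((hasDerivAt_id s).const_mul C))
      fun s => by simpa using hC s
    refine hcont.surjective ?_ ?_
    · refine tendsto_atTop_mono' _ ?_ (tendsto_id.const_mul_atTop hC0)
      filter_upwards [eventually_ge_atTop 0] with s hs
      have := hmono' hs
      simp [hτ0] at this; simpa using this
    · refine tendsto_atBot_mono' _ ?_ (tendsto_id.const_mul_atBot hC0)
      filter_upwards [eventually_le_atBot 0] with s hs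
      have := hmono' hs
      simp [hτ0] at this; simpa using this
  set e := hmono.orderIsoOfSurjective τ hsurj with he
  have heq : ∀ s, e s = τ s := fun s => rfl
  have hinv : ∀ t, τ (e.symm t) = t := fun t => e.apply_symm_apply t
  have hadd' : ∀ t, e.symm (t + τ S) = e.symm t + S := fun t => hmono.injective (by
    rw [hinv, hadd, hinv])
  have he0 : e.symm 0 = 0 := hmono.injective (by rw [hinv, hτ0])
  refine ⟨e.symm, τ S, hT, he0, fun t => ?_, hadd', ?_⟩
  · have := (hd (e.symm t)).of_local_left_inverse e.symm.continuous.continuousAt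
      (inv_pos.2 (hpos _)).ne' (Eventually.of_forall hinv)
    rwa [inv_inv] at this
  · -- `μ t - S t / T` is `T`-periodic, and on one period both terms lie between `0` and `S`.
    have hp : Function.Periodic (fun t => |e.symm t - S / τ S * t|) (τ S) := fun t => by
      simp only [hadd']
      congr 1
      field_simp; ring
    intro t
    obtain ⟨t', ht', htt⟩ := hp.exists_mem_Ico₀ hT t
    rw [htt]
    have h1 : 0 ≤ e.symm t' := he0 ▸ e.symm.monotone ht'.1
    have h2 : e.symm t' ≤ S := by
      have : e.symm (τ S) = S := by rw [← heq]; simp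
      exact this ▸ e.symm.monotone ht'.2.le
    have h3 : 0 ≤ S / τ S * t' := mul_nonneg (by positivity) ht'.1
    have h4 : S / τ S * t' ≤ S := by
      rw [div_mul_eq_mul_div, div_le_iff₀ hT]
      exact mul_le_mul_of_nonneg_left ht'.2.le hS.le
    rw [abs_le]; constructor <;> linarith

/-! ### The mean -/

lemma abs_mul_le_mul {a b A B : ℝ} (ha : |a| ≤ A) (hb : |b| ≤ B) : |a * b| ≤ A * B := by
  rw [abs_mul]
  exact mul_le_mul ha hb (abs_nonneg _) ((abs_nonneg _).trans ha)

section Mean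

variable {N : ℕ}

lemma mean_const (hN : 1 ≤ N) (c : ℝ) : mean (fun _ : Fin N => c) = c := by
  have : (N : ℝ) ≠ 0 := by positivity
  simp [mean, this]

lemma mean_add (v w : Fin N → ℝ) : mean (fun i => v i + w i) = mean v + mean w := by
  simp [mean, Finset.sum_add_distrib, mul_add]

lemma mean_sub (v w : Fin N → ℝ) : mean (fun i => v i - w i) = mean v - mean w := by
  simp [mean, Finset.sum_sub_distrib, mul_sub]

lemma mean_mul_left (c : ℝ) (v : Fin N → ℝ) : mean (fun i => c * v i) = c * mean v := by
  simp [mean, ← Finset.mul_sum]; ring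

lemma abs_mean_le (hN : 1 ≤ N) {v : Fin N → ℝ} {C : ℝ} (h : ∀ i, |v i| ≤ C) : |mean v| ≤ C := by
  have hN' : (0 : ℝ) < N := by exact_mod_cast hN
  rw [mean, abs_mul, abs_of_nonneg (by positivity), one_div, inv_mul_le_iff₀ hN']
  calc |∑ i, v i| ≤ ∑ i, |v i| := Finset.abs_sum_le_sum_abs _ _
    _ ≤ ∑ _i : Fin N, C := Finset.sum_le_sum fun i _ => h i
    _ = N * C := by simp

lemma abs_mean_sub_le (hN : 1 ≤ N) {v w : Fin N → ℝ} {C : ℝ} (h : ∀ i, |v i - w i| ≤ C) :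
    |mean v - mean w| ≤ C := by
  rw [← mean_sub]; exact abs_mean_le hN h

lemma continuous_mean : Continuous (mean : (Fin N → ℝ) → ℝ) := by
  unfold mean; fun_prop

lemma hasDerivWithinAt_mean {x : ℝ → Fin N → ℝ} {x' : Fin N → ℝ} {S : Set ℝ} {t : ℝ}
    (h : HasDerivWithinAt x x' S t) : HasDerivWithinAt (fun t => mean (x t)) (mean x') S t := by
  unfold mean
  exact (HasDerivWithinAt.fun_sum fun i _ => hasDerivWithinAt_pi.1 h i).const_mul _

end Mean

/-! ### The field near the diagonal -/

/-- `B` bounds `P`, `R` and `R'`, is a Lipschitz constant of `P` and `R`, and controls the first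
order Taylor remainder of `R`. -/
structure Bounds (P R : ℝ → ℝ) (B : ℝ) : Prop where
  one_le : 1 ≤ B
  P_le : ∀ x, |P x| ≤ B
  R_le : ∀ x, |R x| ≤ B
  dR_le : ∀ x, |deriv R x| ≤ B
  P_lip : ∀ x y, |P x - P y| ≤ B * |x - y|
  R_lip : ∀ x y, |R x - R y| ≤ B * |x - y|
  taylor : ∀ s x y δ, |x - s| ≤ δ → |y - s| ≤ δ →
    |R x - R y - deriv R s * (x - y)| ≤ B * δ * |x - y|

lemma Bounds.mono {P R : ℝ → ℝ} {B B' : ℝ} (h : Bounds P R B) (hB : B ≤ B') : Bounds P R B' where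
  one_le := h.one_le.trans hB
  P_le x := (h.P_le x).trans hB
  R_le x := (h.R_le x).trans hB
  dR_le x := (h.dR_le x).trans hB
  P_lip x y := (h.P_lip x y).trans (by gcongr)
  R_lip x y := (h.R_lip x y).trans (by gcongr)
  taylor s x y δ hx hy := (h.taylor s x y δ hx hy).trans (by
    have := (abs_nonneg _).trans hx
    gcongr)

lemma abs_sub_le_of_abs_deriv_le {f : ℝ → ℝ} {C : ℝ} (hf : Differentiable ℝ f)
    (hC : ∀ x, |deriv f x| ≤ C) (x y : ℝ) : |f x - f y| ≤ C * |x - y| :=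
  convex_univ.norm_image_sub_le_of_norm_deriv_le (fun z _ => hf z) (fun z _ => hC z)
    (mem_univ y) (mem_univ x)

lemma exists_bounds {P R : ℝ → ℝ} (hP : ContDiff ℝ 2 P) (hR : ContDiff ℝ 2 R)
    (hPper : Function.Periodic P (2 * Real.pi)) (hRper : Function.Periodic R (2 * Real.pi)) :
    ∃ B, Bounds P R B := by
  have hpi : (2 * Real.pi) ≠ 0 := by positivity
  have hP1 : Continuous (deriv P) := hP.continuous_deriv (by norm_num)
  have hR1 : ContDiff ℝ 1 (deriv R) := (contDiff_succ_iff_deriv (n := 1).1 hR).2.2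
  obtain ⟨B₁, h₁⟩ := exists_abs_le_of_periodic hP.continuous hPper hpi
  obtain ⟨B₂, h₂⟩ := exists_abs_le_of_periodic hR.continuous hRper hpi
  obtain ⟨B₃, h₃⟩ := exists_abs_le_of_periodic hP1 (periodic_deriv hPper) hpi
  obtain ⟨B₄, h₄⟩ := exists_abs_le_of_periodic hR1.continuous (periodic_deriv hRper) hpi
  obtain ⟨B₅, h₅⟩ := exists_abs_le_of_periodic (hR1.continuous_deriv le_rfl)
    (periodic_deriv (periodic_deriv hRper)) hpi
  have n₁ := (abs_nonneg _).trans (h₁ 0)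
  have n₂ := (abs_nonneg _).trans (h₂ 0)
  have n₃ := (abs_nonneg _).trans (h₃ 0)
  have n₄ := (abs_nonneg _).trans (h₄ 0)
  have n₅ := (abs_nonneg _).trans (h₅ 0)
  have dP : Differentiable ℝ P := hP.differentiable (by norm_num)
  have dR : Differentiable ℝ R := hR.differentiable (by norm_num)
  have ddR : Differentiable ℝ (deriv R) := hR1.differentiable (by norm_num)
  refine ⟨1 + B₁ + B₂ + B₃ + B₄ + B₅, by linarith, fun x => (h₁ x).trans (by linarith),
    fun x => (h₂ x).trans (by linarith), fun x => (h₄ x).trans (by linarith),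
    abs_sub_le_of_abs_deriv_le dP fun x => (h₃ x).trans (by linarith),
    abs_sub_le_of_abs_deriv_le dR fun x => (h₄ x).trans (by linarith), ?_⟩
  intro s x y δ hx hy
  -- The derivative of `R - R'(s) id` is small on the ball of radius `δ` around `s`.
  have hd : ∀ z, HasDerivAt (fun z => R z - deriv R s * z) (deriv R z - deriv R s * 1) z := fun z =>
    (dR z).hasDerivAt.sub ((hasDerivAt_id z).const_mul _)
  have := (convex_closedBall s δ).norm_image_sub_le_of_norm_hasDerivWithin_le
    (C := (1 + B₁ + B₂ + B₃ + B₄ + B₅) * δ)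
    (fun z _ => (hd z).hasDerivWithinAt) (fun z hz => ?_)
    (show y ∈ Metric.closedBall s δ from hy) (show x ∈ Metric.closedBall s δ from hx)
  · rw [Real.norm_eq_abs, Real.norm_eq_abs] at this
    rwa [show R x - R y - deriv R s * (x - y) =
      R x - deriv R s * x - (R y - deriv R s * y) by ring]
  · rw [mul_one]
    have hz' : |z - s| ≤ δ := hz
    refine (abs_sub_le_of_abs_deriv_le ddR h₅ z s).trans ?_
    have := (abs_nonneg _).trans hz'
    exact mul_le_mul (by linarith) hz' (abs_nonneg _) (by linarith)

section Estimates

variable {P R : ℝ → ℝ} {B κ κ₀ δ η γ s : ℝ} {N : ℕ} {ω X Y : Fin N → ℝ}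

lemma field_apply (P R : ℝ → ℝ) (κ : ℝ) (ω X : Fin N → ℝ) (i : Fin N) :
    field P R κ ω X i = ω i - κ * (mean (fun j => P (X j)) * R (X i)) := by
  simp only [field, mean, Finset.sum_mul, mul_assoc]

lemma mean_field (P R : ℝ → ℝ) (κ : ℝ) (ω X : Fin N → ℝ) :
    mean (field P R κ ω X) =
      mean ω - κ * (mean (fun j => P (X j)) * mean (fun j => R (X j))) := by
  rw [show field P R κ ω X = fun i => ω i - κ * (mean (fun j => P (X j)) * R (X i)) from
    funext (field_apply P R κ ω X), mean_sub, mean_mul_left, mean_mul_left]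

lemma Bounds.abs_mean_P_sub_le (hB : Bounds P R B) (hN : 1 ≤ N) (hX : ∀ i, |X i - s| ≤ δ) :
    |mean (fun j => P (X j)) - P s| ≤ B * δ := by
  have hB0 : 0 ≤ B := by linarith [hB.one_le]
  rw [← mean_const hN (P s)]
  exact abs_mean_sub_le hN fun i => (hB.P_lip _ _).trans (by gcongr; exact hX i)

lemma Bounds.abs_mean_R_sub_le (hB : Bounds P R B) (hN : 1 ≤ N) (hX : ∀ i, |X i - s| ≤ δ) :
    |mean (fun j => R (X j)) - R s| ≤ B * δ := by
  have hB0 : 0 ≤ B := by linarith [hB.one_le]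
  rw [← mean_const hN (R s)]
  exact abs_mean_sub_le hN fun i => (hB.R_lip _ _).trans (by gcongr; exact hX i)

/-- Near the diagonal the mean phase moves with velocity close to `1 - κ₀ P R`. -/
lemma Bounds.abs_mean_field_sub_le (hB : Bounds P R B) (hN : 1 ≤ N) (hX : ∀ i, |X i - s| ≤ δ)
    (hκ₀ : |κ₀| ≤ B) (hκ : |κ - κ₀| ≤ η) (hω : ∀ i, |ω i - 1| ≤ γ) :
    |mean (field P R κ ω X) - (1 - κ₀ * P s * R s)| ≤ γ + B ^ 2 * η + 2 * B ^ 3 * δ := by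
  have hω' : |mean ω - 1| ≤ γ := by
    rw [← mean_const hN 1]; exact abs_mean_sub_le hN hω
  have hp := hB.abs_mean_P_sub_le hN hX
  have hr := hB.abs_mean_R_sub_le hN hX
  have hpB : |mean fun j => P (X j)| ≤ B := abs_mean_le hN fun i => hB.P_le _
  have hrB : |mean fun j => R (X j)| ≤ B := abs_mean_le hN fun i => hB.R_le _
  rw [mean_field]
  set p := mean fun j => P (X j)
  set r := mean fun j => R (X j)
  have e1 := abs_mul_le_mul hκ (abs_mul_le_mul hpB hrB)
  have e2 := abs_mul_le_mul hκ₀ (abs_mul_le_mul hp hrB)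
  have e3 := abs_mul_le_mul hκ₀ (abs_mul_le_mul (hB.P_le s) hr)
  rw [show mean ω - κ * (p * r) - (1 - κ₀ * P s * R s) = (mean ω - 1) - (κ - κ₀) * (p * r)
    - κ₀ * ((p - P s) * r) - κ₀ * (P s * (r - R s)) by ring]
  rw [abs_le] at *
  constructor <;> nlinarith

/-- Near the diagonal the phase differences obey, up to small errors, the linear equation
`d' = -κ₀ P(s) R'(s) d`. -/
lemma Bounds.abs_field_sub_field_le (hB : Bounds P R B) (hN : 1 ≤ N) (hX : ∀ i, |X i - s| ≤ δ)
    (hκ₀ : |κ₀| ≤ B) (hκ : |κ - κ₀| ≤ η) (i j : Fin N) :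
    |field P R κ ω X i - field P R κ ω X j - (ω i - ω j)
      + κ₀ * P s * deriv R s * (X i - X j)| ≤ (B ^ 2 * η + 2 * B ^ 3 * δ) * |X i - X j| := by
  have hp := hB.abs_mean_P_sub_le hN hX
  have hpB : |mean fun j => P (X j)| ≤ B := abs_mean_le hN fun i => hB.P_le _
  have hR := hB.R_lip (X i) (X j)
  have hT := hB.taylor s _ _ δ (hX i) (hX j)
  rw [field_apply, field_apply]
  set p := mean fun j => P (X j)
  have e1 := abs_mul_le_mul hκ (abs_mul_le_mul hpB hR)
  have e2 := abs_mul_le_mul hκ₀ (abs_mul_le_mul hp hR)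
  have e3 := abs_mul_le_mul hκ₀ (abs_mul_le_mul (hB.P_le s) hT)
  rw [show ω i - κ * (p * R (X i)) - (ω j - κ * (p * R (X j))) - (ω i - ω j)
      + κ₀ * P s * deriv R s * (X i - X j) = -((κ - κ₀) * (p * (R (X i) - R (X j))))
    - κ₀ * ((p - P s) * (R (X i) - R (X j)))
    - κ₀ * (P s * (R (X i) - R (X j) - deriv R s * (X i - X j))) by ring]
  rw [abs_le] at e1 e2 e3 ⊢
  constructor <;> nlinarith

/-- The deviation of the field from its mean is small near the diagonal. -/
lemma Bounds.abs_field_sub_mean_le (hB : Bounds P R B) (hN : 1 ≤ N) (hX : ∀ i, |X i - s| ≤ δ)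
    (hκ : |κ| ≤ B) (hω : ∀ i, |ω i - 1| ≤ γ) (i : Fin N) :
    |field P R κ ω X i - mean (field P R κ ω X)| ≤ 2 * γ + 2 * B ^ 3 * δ := by
  have hω' : |mean ω - 1| ≤ γ := by
    rw [← mean_const hN 1]; exact abs_mean_sub_le hN hω
  have hωi := hω i
  have hpB : |mean fun j => P (X j)| ≤ B := abs_mean_le hN fun i => hB.P_le _
  have hr := hB.abs_mean_R_sub_le hN hX
  have hB0 : 0 ≤ B := by linarith [hB.one_le]
  have hRi : |R (X i) - R s| ≤ B * δ := (hB.R_lip _ _).trans (by gcongr; exact hX i)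
  rw [field_apply, mean_field]
  have e1 := abs_mul_le_mul hκ (abs_mul_le_mul hpB hr)
  have e2 := abs_mul_le_mul hκ (abs_mul_le_mul hpB hRi)
  rw [abs_le] at hω' hωi e1 e2 ⊢
  constructor <;> nlinarith

/-- Lipschitz estimate for the mean of the field. -/
lemma Bounds.abs_mean_field_sub_mean_field_le (hB : Bounds P R B) (hN : 1 ≤ N) (hκ : |κ| ≤ B)
    {D : ℝ} (hD : ∀ i, |X i - Y i| ≤ D) :
    |mean (field P R κ ω X) - mean (field P R κ ω Y)| ≤ 2 * B ^ 3 * D := by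
  have hB0 : 0 ≤ B := by linarith [hB.one_le]
  have hpp : |mean (fun j => P (X j)) - mean (fun j => P (Y j))| ≤ B * D :=
    abs_mean_sub_le hN fun i => (hB.P_lip _ _).trans (by gcongr; exact hD i)
  have hrr : |mean (fun j => R (X j)) - mean (fun j => R (Y j))| ≤ B * D :=
    abs_mean_sub_le hN fun i => (hB.R_lip _ _).trans (by gcongr; exact hD i)
  have hp : |mean fun j => P (Y j)| ≤ B := abs_mean_le hN fun i => hB.P_le _
  have hr : |mean fun j => R (X j)| ≤ B := abs_mean_le hN fun i => hB.R_le _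
  rw [mean_field, mean_field]
  have e1 := abs_mul_le_mul hκ (abs_mul_le_mul hpp hr)
  have e2 := abs_mul_le_mul hκ (abs_mul_le_mul hp hrr)
  rw [abs_le] at e1 e2 ⊢
  constructor <;> nlinarith

/-- The deviation of the field from its mean depends on two states with the same mean phase, up
to small errors, through the linear term `-κ₀ P(s) R'(s) (X i - Y i)`. -/
lemma Bounds.abs_deviation_sub_deviation_le (hB : Bounds P R B) (hN : 1 ≤ N)
    (hX : ∀ i, |X i - s| ≤ δ) (hY : ∀ i, |Y i - s| ≤ δ) (hXY : mean X = mean Y)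
    (hκ : |κ| ≤ B) (hκ₀ : |κ₀| ≤ B) (hη : |κ - κ₀| ≤ η)
    {D : ℝ} (hD : ∀ i, |X i - Y i| ≤ D) (i : Fin N) :
    |(field P R κ ω X i - mean (field P R κ ω X)) - (field P R κ ω Y i - mean (field P R κ ω Y))
      + κ₀ * P s * deriv R s * (X i - Y i)| ≤ (2 * B ^ 2 * η + 6 * B ^ 3 * δ) * D := by
  have hB0 : 0 ≤ B := by linarith [hB.one_le]
  have hδ : 0 ≤ δ := (abs_nonneg _).trans (hX i)
  have hpp : |mean (fun j => P (X j)) - mean (fun j => P (Y j))| ≤ B * D :=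
    abs_mean_sub_le hN fun i => (hB.P_lip _ _).trans (by gcongr; exact hD i)
  have hp : |mean fun j => P (Y j)| ≤ B := abs_mean_le hN fun i => hB.P_le _
  have hps := hB.abs_mean_P_sub_le hN hY
  have hrX : |R (X i) - mean (fun j => R (X j))| ≤ 2 * B * δ := by
    have h1 := hB.abs_mean_R_sub_le hN hX
    have h2 : |R (X i) - R s| ≤ B * δ := (hB.R_lip _ _).trans (by gcongr; exact hX i)
    rw [abs_le] at h1 h2 ⊢; constructor <;> linarith
  have hrr : |mean (fun j => R (X j)) - mean (fun j => R (Y j))| ≤ B * D :=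
    abs_mean_sub_le hN fun i => (hB.R_lip _ _).trans (by gcongr; exact hD i)
  have hRR : |R (X i) - R (Y i)| ≤ B * D := (hB.R_lip _ _).trans (by gcongr; exact hD i)
  have hT : |R (X i) - R (Y i) - deriv R s * (X i - Y i)| ≤ B * δ * D :=
    (hB.taylor s _ _ δ (hX i) (hY i)).trans (by gcongr; exact hD i)
  -- Since `X` and `Y` have the same mean, the linear term of `R` averages out.
  have hTm : |mean (fun j => R (X j)) - mean (fun j => R (Y j))| ≤ B * δ * D := by
    have : mean (fun j => R (X j) - R (Y j) - deriv R s * (X j - Y j)) =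
        mean (fun j => R (X j)) - mean (fun j => R (Y j)) := by
      rw [mean_sub, mean_sub, mean_mul_left, mean_sub, show mean (fun i => X i) = mean X from rfl,
        show mean (fun i => Y i) = mean Y from rfl, hXY]
      ring
    rw [← this]
    exact abs_mean_le hN fun j =>
      (hB.taylor s _ _ δ (hX j) (hY j)).trans (by gcongr; exact hD j)
  have hd : |R (X i) - R (Y i) - (mean (fun j => R (X j)) - mean (fun j => R (Y j)))| ≤
      2 * B * D := by
    rw [abs_le] at hRR hrr ⊢; constructor <;> linarith
  have hT2 : |R (X i) - R (Y i) - (mean (fun j => R (X j)) - mean (fun j => R (Y j)))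
      - deriv R s * (X i - Y i)| ≤ 2 * B * δ * D := by
    rw [abs_le] at hT hTm ⊢; constructor <;> linarith
  simp only [field_apply, mean_field]
  have e1 := abs_mul_le_mul hκ (abs_mul_le_mul hpp hrX)
  have e2 := abs_mul_le_mul hη (abs_mul_le_mul hp hd)
  have e3 := abs_mul_le_mul hκ₀ (abs_mul_le_mul hps hd)
  have e4 := abs_mul_le_mul hκ₀ (abs_mul_le_mul (hB.P_le s) hT2)
  generalize mean (fun j => P (X j)) = pX at *
  generalize mean (fun j => P (Y j)) = pY at *
  generalize mean (fun j => R (X j)) = rX at *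
  generalize mean (fun j => R (Y j)) = rY at *
  rw [show ω i - κ * (pX * R (X i)) - (mean ω - κ * (pX * rX))
      - (ω i - κ * (pY * R (Y i)) - (mean ω - κ * (pY * rY)))
      + κ₀ * P s * deriv R s * (X i - Y i) =
    -(κ * ((pX - pY) * (R (X i) - rX)))
    - (κ - κ₀) * (pY * (R (X i) - R (Y i) - (rX - rY)))
    - κ₀ * ((pY - P s) * (R (X i) - R (Y i) - (rX - rY)))
    - κ₀ * (P s * (R (X i) - R (Y i) - (rX - rY) - deriv R s * (X i - Y i))) by ring]
  rw [abs_le] at e1 e2 e3 e4 ⊢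
  constructor <;> nlinarith

end Estimates

/-! ### The periodic weight -/

/-- `w` is a positive periodic solution of `w' = (m - a) w`, where
`a = κ₀ P R' / (1 - κ₀ P R)` is the contraction rate of phase differences per unit of mean phase
and `m > 0` is its average. The constants `c` and `W` bound `1 - κ₀ P R` and `w`, `1 / w`. -/
structure IsWeight (P R : ℝ → ℝ) (κ₀ c m W : ℝ) (w : ℝ → ℝ) : Prop where
  c_pos : 0 < c
  le_speed : ∀ s, c ≤ 1 - κ₀ * P s * R s
  m_pos : 0 < m
  one_le : 1 ≤ W
  contDiff : ContDiff ℝ 2 w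
  periodic : Function.Periodic w (2 * Real.pi)
  pos : ∀ s, 0 < w s
  le : ∀ s, w s ≤ W
  inv_le : ∀ s, (w s)⁻¹ ≤ W
  hasDerivAt : ∀ s, HasDerivAt w
    ((m - κ₀ * P s * deriv R s / (1 - κ₀ * P s * R s)) * w s) s

lemma exists_weight {P R : ℝ → ℝ} {κ₀ : ℝ} (hP : ContDiff ℝ 2 P) (hR : ContDiff ℝ 2 R)
    (hPper : Function.Periodic P (2 * Real.pi)) (hRper : Function.Periodic R (2 * Real.pi))
    (hκ₀ : 0 < κ₀) (hpos : ∀ s, 0 < 1 - κ₀ * P s * R s)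
    (hint : 0 < ∫ s in (0 : ℝ)..(2 * Real.pi), P s * deriv R s / (1 - κ₀ * P s * R s)) :
    ∃ (c m W : ℝ) (w : ℝ → ℝ), IsWeight P R κ₀ c m W w := by
  have hpi : 0 < 2 * Real.pi := by positivity
  have hR1 : ContDiff ℝ 1 (deriv R) := (contDiff_succ_iff_deriv (n := 1).1 hR).2.2
  have hP1 : ContDiff ℝ 1 P := hP.of_le (by norm_num)
  have hR1' : ContDiff ℝ 1 R := hR.of_le (by norm_num)
  set a : ℝ → ℝ := fun s => κ₀ * P s * deriv R s / (1 - κ₀ * P s * R s) with ha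
  have ha1 : ContDiff ℝ 1 a :=
    ((contDiff_const.mul hP1).mul hR1).div
      (contDiff_const.sub ((contDiff_const.mul hP1).mul hR1')) fun s => (hpos s).ne'
  have haper : Function.Periodic a (2 * Real.pi) := fun s => by
    simp only [ha, hPper s, hRper s, periodic_deriv hRper s]
  obtain ⟨c, hc, hcle⟩ := exists_pos_le_of_periodic
    (f := fun s => 1 - κ₀ * P s * R s)
    (continuous_const.sub ((continuous_const.mul hP.continuous).mul hR.continuous))
    (fun s => by simp only [hPper s, hRper s]) hpi.ne' hpos
  have hA : 0 < ∫ s in (0 : ℝ)..(2 * Real.pi), a s := by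
    have : a = fun s => κ₀ * (P s * deriv R s / (1 - κ₀ * P s * R s)) := by
      funext s; simp only [ha]; ring
    rw [this, intervalIntegral.integral_const_mul]
    exact mul_pos hκ₀ hint
  set m : ℝ := (∫ s in (0 : ℝ)..(2 * Real.pi), a s) / (2 * Real.pi) with hm
  set b : ℝ → ℝ := fun s => m - a s with hb
  have hb1 : ContDiff ℝ 1 b := contDiff_const.sub ha1
  have hbper : Function.Periodic b (2 * Real.pi) := fun s => by simp only [hb, haper s]
  have hii : ∀ x y, IntervalIntegrable b volume x y := fun x y => hb1.continuous.intervalIntegrable _ _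
  set I : ℝ → ℝ := fun s => ∫ σ in (0 : ℝ)..s, b σ with hI
  have hId : ∀ s, HasDerivAt I (b s) s := fun s =>
    (hb1.continuous.integral_hasStrictDerivAt 0 s).hasDerivAt
  have hI2 : ContDiff ℝ 2 I := contDiff_succ_iff_deriv (n := 1).2
    ⟨fun s => (hId s).differentiableAt, by simp, by
      rwa [show deriv I = b from funext fun s => (hId s).deriv]⟩
  have hb0 : ∫ s in (0 : ℝ)..(2 * Real.pi), b s = 0 := by
    simp only [hb]
    rw [intervalIntegral.integral_sub intervalIntegrable_const
      (ha1.continuous.intervalIntegrable _ _), intervalIntegral.integral_const, smul_eq_mul, hm]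
    field_simp; ring
  have hIper : Function.Periodic I (2 * Real.pi) := fun s => by
    have := hbper.intervalIntegral_add_eq s 0
    rw [zero_add, hb0] at this
    simp only [hI]
    rw [← intervalIntegral.integral_add_adjacent_intervals (hii 0 s) (hii s _), this, add_zero]
  obtain ⟨B, hB⟩ := exists_abs_le_of_periodic hI2.continuous hIper hpi.ne'
  refine ⟨c, m, Real.exp B, fun s => Real.exp (I s), hc, hcle, div_pos hA hpi,
    Real.one_le_exp ((abs_nonneg _).trans (hB 0)), hI2.exp, fun s => by simp only [hIper s],
    fun s => Real.exp_pos _, fun s => Real.exp_le_exp.2 ((le_abs_self _).trans (hB s)),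
    fun s => ?_, fun s => ?_⟩
  · rw [← Real.exp_neg]; exact Real.exp_le_exp.2 ((neg_le_abs _).trans (hB s))
  · exact (hId s).exp.congr_deriv (mul_comm _ _)

/-- `defectConst B c W * ε` is a Lipschitz constant, at distance `W ε` from the diagonal, of the
nonlinear part of the equation for the deviations from the mean phase. -/
noncomputable def defectConst (B c W : ℝ) : ℝ :=
  (2 * B ^ 2 + 6 * B ^ 3 * W + B ^ 3 / c * (1 + B ^ 2 + 2 * B ^ 3 * W)
    + 4 * B ^ 3 * (2 + 2 * B ^ 3 * W) / c) * (2 / c)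

lemma defectConst_nonneg {B c W : ℝ} (hB : 0 ≤ B) (hc : 0 ≤ c) (hW : 0 ≤ W) :
    0 ≤ defectConst B c W := by
  unfold defectConst; positivity

/-- The scale `ε` of the tube is so small that the error terms, all of relative order `ε`, are
dominated by the average contraction rate `m`. -/
structure IsSmall (B c m W ε : ℝ) : Prop where
  pos : 0 < ε
  le_half : ε ≤ 1 / 2
  mul_le : W * ε ≤ 1 / 2
  speed : (1 + B ^ 2 + 2 * B ^ 3 * W) * ε ≤ c / 2
  barrier : (2 * W + (1 + B ^ 3 / c + m) * (1 + B ^ 2 + 2 * B ^ 3 * W)) * ε < m * c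
  lip : defectConst B c W * ε < m
  ball : W * (4 / c + defectConst B c W * W) * ε ≤ m / 4

lemma exists_small (B : ℝ) {c m : ℝ} (W : ℝ) (hc : 0 < c) (hm : 0 < m) :
    ∀ᶠ ε in 𝓝[>] (0 : ℝ), IsSmall B c m W ε := by
  have key : ∀ K C : ℝ, 0 < C → ∀ᶠ ε in 𝓝[>] (0 : ℝ), K * ε < C := fun K C hC => by
    have : Tendsto (fun ε : ℝ => K * ε) (𝓝[>] 0) (𝓝 (K * 0)) :=
      (continuous_const_mul K).continuousAt.tendsto.mono_left nhdsWithin_le_nhds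
    rw [mul_zero] at this
    exact this.eventually_lt_const hC
  filter_upwards [self_mem_nhdsWithin, key 1 (1 / 2) (by norm_num), key W (1 / 2) (by norm_num),
    key (1 + B ^ 2 + 2 * B ^ 3 * W) (c / 2) (by positivity),
    key _ (m * c) (by positivity), key _ m hm, key _ (m / 4) (by positivity)]
    with ε h0 h1 h2 h3 h4 h5 h6
  exact ⟨h0, by linarith, h2.le, h3.le, h4, h5, h6.le⟩

section

variable {P R : ℝ → ℝ} {B κ κ₀ c m W ε γ : ℝ} {w : ℝ → ℝ} {N : ℕ} {ω : Fin N → ℝ}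

lemma IsWeight.abs_rate_le (hw : IsWeight P R κ₀ c m W w) (hB : Bounds P R B) (hκ₀ : |κ₀| ≤ B)
    (s : ℝ) : |κ₀ * P s * deriv R s / (1 - κ₀ * P s * R s)| ≤ B ^ 3 / c := by
  have h := hw.le_speed s
  have hc := hw.c_pos
  have hB0 : 0 ≤ B := by linarith [hB.one_le]
  rw [abs_div, abs_of_pos (hc.trans_le h)]
  have := abs_mul_le_mul (abs_mul_le_mul hκ₀ (hB.P_le s)) (hB.dR_le s)
  gcongr
  linarith

/-- Speed estimate: within distance `W ε` of the diagonal the mean phase moves with velocity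
`1 - κ₀ P R` up to an error of order `ε`. -/
lemma IsSmall.abs_speed_sub_le (hε : IsSmall B c m W ε) (hB : Bounds P R B) (hN : 1 ≤ N)
    (hκ₀ : |κ₀| ≤ B) (hκ : |κ - κ₀| ≤ ε) (hγ : γ ≤ ε ^ 2) (hω : ∀ i, |ω i - 1| ≤ γ)
    {X : Fin N → ℝ} {s : ℝ} (hX : ∀ i, |X i - s| ≤ W * ε) :
    |mean (field P R κ ω X) - (1 - κ₀ * P s * R s)| ≤ (1 + B ^ 2 + 2 * B ^ 3 * W) * ε := by
  refine (hB.abs_mean_field_sub_le hN hX hκ₀ hκ hω).trans ?_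
  have := hε.pos
  have := hε.le_half
  nlinarith

lemma IsSmall.half_le_speed (hε : IsSmall B c m W ε) (hw : IsWeight P R κ₀ c m W w)
    (hB : Bounds P R B) (hN : 1 ≤ N)
    (hκ₀ : |κ₀| ≤ B) (hκ : |κ - κ₀| ≤ ε) (hγ : γ ≤ ε ^ 2) (hω : ∀ i, |ω i - 1| ≤ γ)
    {X : Fin N → ℝ} {s : ℝ} (hX : ∀ i, |X i - s| ≤ W * ε) :
    c / 2 ≤ mean (field P R κ ω X) := by
  have h := hε.abs_speed_sub_le hB hN hκ₀ hκ hγ hω hX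
  have h1 := hw.le_speed s
  have h2 := hε.speed
  rw [abs_le] at h
  linarith

/-! ### Invariance of the tube -/

lemma abs_sub_mean_le (hN : 1 ≤ N) {X : Fin N → ℝ} {δ : ℝ} (h : ∀ i j, |X j - X i| ≤ δ)
    (i : Fin N) : |X i - mean X| ≤ δ := by
  rw [← mean_const hN (X i)]
  exact abs_mean_sub_le hN fun j => by rw [abs_sub_comm]; exact h i j

/-- On the boundary of the tube `|X j - X i| ≤ ε w(mean X)` the field points strictly inwards. -/
lemma IsSmall.deriv_neg_of_boundary (hε : IsSmall B c m W ε) (hw : IsWeight P R κ₀ c m W w)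
    (hB : Bounds P R B) (hN : 1 ≤ N)
    (hκ₀ : |κ₀| ≤ B) (hκ : |κ - κ₀| ≤ ε) (hγ : γ ≤ ε ^ 2) (hω : ∀ i, |ω i - 1| ≤ γ)
    {X : Fin N → ℝ} (hX : ∀ i j, |X j - X i| ≤ ε * w (mean X)) {i j : Fin N}
    (hij : X i - X j = ε * w (mean X)) :
    field P R κ ω X i - field P R κ ω X j - ε * ((m - κ₀ * P (mean X) * deriv R (mean X) /
      (1 - κ₀ * P (mean X) * R (mean X))) * w (mean X)) * mean (field P R κ ω X) < 0 := by
  set s := mean X with hs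
  have hε0 := hε.pos
  have hδ : ∀ i, |X i - s| ≤ W * ε := fun i =>
    (abs_sub_mean_le hN hX i).trans (by rw [mul_comm]; gcongr; exact hw.le s)
  have hspeed := hε.abs_speed_sub_le hB hN hκ₀ hκ hγ hω hδ
  have hdiff := hB.abs_field_sub_field_le (ω := ω) hN hδ hκ₀ hκ i j
  have hrate := hw.abs_rate_le hB hκ₀ s
  have hωi := hω i
  have hωj := hω j
  have hwpos := hw.pos s
  have hf := hw.le_speed s
  have hf0 : (1 - κ₀ * P s * R s) ≠ 0 := by linarith [hw.c_pos]
  have hm := hw.m_pos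
  have hB1 := hB.one_le
  have hbar := hε.barrier
  have hinv : 1 ≤ W * w s := by
    have := hw.inv_le s
    rwa [inv_le_iff_one_le_mul₀ hwpos] at this
  set f := 1 - κ₀ * P s * R s with hfdef
  set a := κ₀ * P s * deriv R s / f with ha
  have haf : κ₀ * P s * deriv R s = a * f := by rw [ha]; field_simp
  rw [haf] at hdiff
  set F := mean (field P R κ ω X)
  rw [hij] at hdiff
  set d := ε * w s with hd
  have hdpos : 0 < d := by positivity
  rw [abs_of_pos hdpos] at hdiff
  set K := 1 + B ^ 2 + 2 * B ^ 3 * W with hK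
  have hK0 : 0 ≤ K := by
    have := hw.one_le
    positivity
  -- The frequency spread is at most `2 ε²`, which is small compared with `ε ≤ W d`.
  have hγd : 2 * γ ≤ 2 * W * ε * d := by nlinarith
  have e0 : (B ^ 2 * ε + 2 * B ^ 3 * (W * ε)) * d ≤ K * ε * d := by
    have : 0 ≤ ε * d := by positivity
    rw [hK]; nlinarith
  have e1 : |(m - a) * (F - f)| ≤ (m + B ^ 3 / c) * (K * ε) := by
    refine abs_mul_le_mul ?_ hspeed
    rw [abs_le] at hrate ⊢; constructor <;> linarith
  have e2 : (m + B ^ 3 / c) * (K * ε) * d ≥ -((m - a) * (F - f)) * d :=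
    mul_le_mul_of_nonneg_right (by rw [abs_le] at e1; linarith) hdpos.le
  have e3 : m * c * d ≤ m * f * d := by gcongr
  have e4 := mul_lt_mul_of_pos_right hbar hdpos
  rw [abs_le] at hdiff hωi hωj
  have e5 := hdiff.2
  calc field P R κ ω X i - field P R κ ω X j - ε * ((m - a) * w s) * F
      = (field P R κ ω X i - field P R κ ω X j - (ω i - ω j) + a * f * d) + (ω i - ω j)
        - m * f * d - (m - a) * (F - f) * d := by rw [hd]; ring
    _ < 0 := by nlinarith

lemma isOpen_tube {Δ : ℝ → ℝ} (hΔ : Continuous Δ) : IsOpen (tube N Δ) := by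
  simp only [tube, ofPred_forall]
  refine isOpen_iInter_of_finite fun i => isOpen_iInter_of_finite fun j => ?_
  exact isOpen_lt (by fun_prop) (hΔ.comp continuous_mean)

/-- Every solution starting in the tube stays there. -/
lemma IsSmall.mem_tube (hε : IsSmall B c m W ε) (hw : IsWeight P R κ₀ c m W w)
    (hB : Bounds P R B) (hN : 1 ≤ N)
    (hκ₀ : |κ₀| ≤ B) (hκ : |κ - κ₀| ≤ ε) (hγ : γ ≤ ε ^ 2) (hω : ∀ i, |ω i - 1| ≤ γ)
    {x : ℝ → Fin N → ℝ} (hx : IsSolution P R κ ω x) (hx0 : x 0 ∈ tube N fun s => ε * w s)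
    {t : ℝ} (ht : 0 ≤ t) : x t ∈ tube N fun s => ε * w s := by
  have habs : ∀ {y : Fin N → ℝ} {b : ℝ}, (∀ p : Fin N × Fin N, y p.1 - y p.2 ≤ b) →
      ∀ i j, |y j - y i| ≤ b := fun h i j =>
    abs_le.2 ⟨by linarith [h (i, j)], h (j, i)⟩
  have key := forall_neg_of_barrier (ι := Fin N × Fin N)
    (g := fun p t => x t p.1 - x t p.2 - ε * w (mean (x t)))
    (g' := fun p t => field P R κ ω (x t) p.1 - field P R κ ω (x t) p.2 -
      ε * ((m - κ₀ * P (mean (x t)) * deriv R (mean (x t)) /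
        (1 - κ₀ * P (mean (x t)) * R (mean (x t)))) * w (mean (x t))) *
          mean (field P R κ ω (x t)))
    (fun p t ht => by
      have h := hx t ht
      have h1 := ((hw.hasDerivAt (mean (x t))).comp_hasDerivWithinAt t
        (hasDerivWithinAt_mean h)).const_mul ε
      refine (((hasDerivWithinAt_pi.1 h p.1).sub (hasDerivWithinAt_pi.1 h p.2)).sub h1).congr_deriv ?_
      ring)
    (fun p => by linarith [le_abs_self (x 0 p.1 - x 0 p.2), hx0 p.2 p.1])
    (fun t ht hle p hp => hε.deriv_neg_of_boundary hw hB hN hκ₀ hκ hγ hω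
      (habs fun p => by linarith [hle p]) (by linarith))
  intro i j
  have h1 := key t ht (i, j)
  have h2 := key t ht (j, i)
  exact abs_lt.2 ⟨by linarith, by linarith⟩

lemma Bounds.lipschitz_field (hB : Bounds P R B) (hN : 1 ≤ N) (hκ : |κ| ≤ B) :
    ∃ K, LipschitzWith K (field P R κ ω) := by
  have hB0 : 0 ≤ B := by linarith [hB.one_le]
  refine ⟨(2 * B ^ 3).toNNReal, LipschitzWith.of_dist_le_mul fun X Y => ?_⟩
  rw [Real.coe_toNNReal _ (by positivity)]
  refine (dist_pi_le_iff (by positivity)).2 fun i => ?_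
  have hD : ∀ i, |X i - Y i| ≤ dist X Y := fun i => dist_le_pi_dist X Y i
  have hpp : |mean (fun j => P (X j)) - mean (fun j => P (Y j))| ≤ B * dist X Y :=
    abs_mean_sub_le hN fun i => (hB.P_lip _ _).trans (by gcongr; exact hD i)
  have hRR : |R (X i) - R (Y i)| ≤ B * dist X Y :=
    (hB.R_lip _ _).trans (by gcongr; exact hD i)
  have hp : |mean fun j => P (Y j)| ≤ B := abs_mean_le hN fun i => hB.P_le _
  have e1 := abs_mul_le_mul hκ (abs_mul_le_mul hpp (hB.R_le (X i)))
  have e2 := abs_mul_le_mul hκ (abs_mul_le_mul hp hRR)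
  rw [Real.dist_eq, field_apply, field_apply]
  rw [abs_le] at e1 e2 ⊢
  constructor <;> nlinarith

lemma Bounds.norm_field_le (hB : Bounds P R B) (hN : 1 ≤ N) (hκ : |κ| ≤ B)
    (hω : ∀ i, |ω i - 1| ≤ 1) (X : Fin N → ℝ) : ‖field P R κ ω X‖ ≤ 2 + B ^ 3 := by
  have hB0 : 0 ≤ B := by linarith [hB.one_le]
  refine (pi_norm_le_iff_of_nonneg (by positivity)).2 fun i => ?_
  have hp : |mean fun j => P (X j)| ≤ B := abs_mean_le hN fun i => hB.P_le _
  have e1 := abs_mul_le_mul hκ (abs_mul_le_mul hp (hB.R_le (X i)))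
  have := hω i
  rw [Real.norm_eq_abs, field_apply]
  rw [abs_le] at *
  constructor <;> nlinarith

end

/-! ### The periodic orbit with the mean phase as time -/

/-- The nonlinearity of the equation for the deviations `y` from the mean phase `s`, when `s` is
used as time: `dy/ds = -a(s) y + defect s y` with `a = κ₀ P R' / (1 - κ₀ P R)`. -/
noncomputable def defect (P R : ℝ → ℝ) (κ κ₀ : ℝ) {N : ℕ} (ω : Fin N → ℝ) (s : ℝ)
    (y : Fin N → ℝ) : Fin N → ℝ := fun i =>
  (field P R κ ω (fun j => s + y j) i - mean (field P R κ ω fun j => s + y j)) /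
    mean (field P R κ ω fun j => s + y j) +
      κ₀ * P s * deriv R s / (1 - κ₀ * P s * R s) * y i

/-- The deviations from the mean phase: vectors of mean zero. -/
noncomputable abbrev zeroMean (N : ℕ) : Submodule ℝ (Fin N → ℝ) where
  carrier := {y | mean y = 0}
  add_mem' {a b} (ha : mean a = 0) (hb : mean b = 0) := by
    change mean (fun i => a i + b i) = 0
    rw [mean_add, ha, hb, add_zero]
  zero_mem' := by simp [mean]
  smul_mem' r a (ha : mean a = 0) := by
    change mean (fun i => r * a i) = 0
    rw [mean_mul_left, ha, mul_zero]

section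

variable {P R : ℝ → ℝ} {B κ κ₀ c m W ε γ : ℝ} {w : ℝ → ℝ} {N : ℕ} {ω : Fin N → ℝ}

lemma mean_defect (hN : 1 ≤ N) (s : ℝ) {y : Fin N → ℝ} (hy : mean y = 0) :
    mean (defect P R κ κ₀ ω s y) = 0 := by
  unfold defect
  simp only [div_eq_inv_mul _ (mean (field P R κ ω fun j => s + y j))]
  rw [mean_add, mean_mul_left, mean_mul_left, mean_sub, mean_const hN,
    show mean (fun i => y i) = mean y from rfl, hy]
  simp

lemma mean_const_add (hN : 1 ≤ N) (s : ℝ) {y : Fin N → ℝ} (hy : mean y = 0) :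
    mean (fun j => s + y j) = s := by
  rw [mean_add, mean_const hN, show mean (fun i => y i) = mean y from rfl, hy, add_zero]

/-- After division by the speed of the mean phase, the deviation equation is linear up to a term
with Lipschitz constant of order `ε`. -/
lemma IsSmall.abs_defect_sub_le (hε : IsSmall B c m W ε) (hw : IsWeight P R κ₀ c m W w)
    (hB : Bounds P R B) (hN : 1 ≤ N) (hκB : |κ| ≤ B)
    (hκ₀ : |κ₀| ≤ B) (hκ : |κ - κ₀| ≤ ε) (hγ : γ ≤ ε ^ 2) (hω : ∀ i, |ω i - 1| ≤ γ)
    (s : ℝ) {y z : Fin N → ℝ} (hy : mean y = 0) (hz : mean z = 0)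
    (hyε : ∀ i, |y i| ≤ W * ε) (hzε : ∀ i, |z i| ≤ W * ε) {D : ℝ}
    (hD : ∀ i, |y i - z i| ≤ D) (i : Fin N) :
    |defect P R κ κ₀ ω s y i - defect P R κ κ₀ ω s z i| ≤
      defectConst B c W * ε * D := by
  have hε0 := hε.pos
  have hc := hw.c_pos
  have hW := hw.one_le
  have hB1 := hB.one_le
  have hY : ∀ i, |(s + y i) - s| ≤ W * ε := fun i => by simpa using hyε i
  have hZ : ∀ i, |(s + z i) - s| ≤ W * ε := fun i => by simpa using hzε i
  have hYZ : ∀ i, |(s + y i) - (s + z i)| ≤ D := fun i => by simpa using hD i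
  have hd := hε.half_le_speed hw hB hN hκ₀ hκ hγ hω hY
  have hd' := hε.half_le_speed hw hB hN hκ₀ hκ hγ hω hZ
  have hs := hε.abs_speed_sub_le hB hN hκ₀ hκ hγ hω hY
  have hn := hB.abs_field_sub_mean_le hN hZ hκB hω i
  have hdd := hB.abs_mean_field_sub_mean_field_le (ω := ω) hN hκB hYZ
  have hnn := hB.abs_deviation_sub_deviation_le (ω := ω) hN hY hZ
    (by rw [mean_const_add hN s hy, mean_const_add hN s hz]) hκB hκ₀ hκ hYZ i
  have hrate := hw.abs_rate_le hB hκ₀ s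
  have hf := hw.le_speed s
  have hf0 : (1 - κ₀ * P s * R s) ≠ 0 := by linarith
  have hDi := hD i
  have hD0 : 0 ≤ D := (abs_nonneg _).trans hDi
  unfold defect defectConst
  set f := 1 - κ₀ * P s * R s
  set a := κ₀ * P s * deriv R s / f with ha
  have haf : κ₀ * P s * deriv R s = a * f := by rw [ha]; field_simp
  rw [haf] at hnn
  generalize mean (field P R κ ω fun j => s + y j) = dY at *
  generalize mean (field P R κ ω fun j => s + z j) = dZ at *
  generalize field P R κ ω (fun j => s + y j) i = FY at *
  generalize field P R κ ω (fun j => s + z j) i = FZ at *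
  set K := 1 + B ^ 2 + 2 * B ^ 3 * W with hK
  have hdY : 0 < dY := by linarith
  have hdZ : 0 < dZ := by linarith
  have e1 : |(FY - dY) - (FZ - dZ) + a * f * (y i - z i)| ≤
      (2 * B ^ 2 + 6 * B ^ 3 * W) * ε * D := by
    rw [show s + y i - (s + z i) = y i - z i by ring] at hnn
    exact hnn.trans (le_of_eq (by ring))
  have e2 := abs_mul_le_mul hrate (abs_mul_le_mul hDi hs)
  have e3 : |(FZ - dZ) / dZ| ≤ (2 + 2 * B ^ 3 * W) * ε * (2 / c) := by
    rw [abs_div, abs_of_pos hdZ, div_le_iff₀ hdZ]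
    calc |FZ - dZ| ≤ (2 + 2 * B ^ 3 * W) * ε := by
          have := hε.le_half
          refine hn.trans ?_
          nlinarith
      _ = (2 + 2 * B ^ 3 * W) * ε * (2 / c) * (c / 2) := by field_simp
      _ ≤ (2 + 2 * B ^ 3 * W) * ε * (2 / c) * dZ := by gcongr
  have e4 := abs_mul_le_mul e3 hdd
  have split : (FY - dY) / dY + a * y i - ((FZ - dZ) / dZ + a * z i) =
      (((FY - dY) - (FZ - dZ) + a * f * (y i - z i)) + a * ((y i - z i) * (dY - f))
        - (FZ - dZ) / dZ * (dY - dZ)) / dY := by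
    field_simp; ring
  rw [split, abs_div, abs_of_pos hdY, div_le_iff₀ hdY]
  set C := 2 * B ^ 2 + 6 * B ^ 3 * W + B ^ 3 / c * K + 4 * B ^ 3 * (2 + 2 * B ^ 3 * W) / c with hC
  have hC0 : 0 ≤ C := by positivity
  calc _ ≤ C * ε * D := by
        have : C * ε * D = (2 * B ^ 2 + 6 * B ^ 3 * W) * ε * D + B ^ 3 / c * (D * (K * ε))
          + (2 + 2 * B ^ 3 * W) * ε * (2 / c) * (2 * B ^ 3 * D) := by rw [hC]; ring
        rw [this]
        rw [abs_le] at e1 e2 e4 ⊢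
        constructor <;> linarith
    _ = C * (2 / c) * ε * D * (c / 2) := by field_simp
    _ ≤ C * (2 / c) * ε * D * dY := by gcongr

lemma IsSmall.abs_defect_le (hε : IsSmall B c m W ε) (hw : IsWeight P R κ₀ c m W w)
    (hB : Bounds P R B) (hN : 1 ≤ N) (hκB : |κ| ≤ B)
    (hκ₀ : |κ₀| ≤ B) (hκ : |κ - κ₀| ≤ ε) (hγ : γ ≤ ε ^ 2) (hω : ∀ i, |ω i - 1| ≤ γ)
    (s : ℝ) {y : Fin N → ℝ} (hy : mean y = 0) (hyε : ∀ i, |y i| ≤ W * ε) (i : Fin N) :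
    W * |defect P R κ κ₀ ω s y i| ≤ m * (ε / 4) := by
  have hε0 := hε.pos
  have hc := hw.c_pos
  have hW := hw.one_le
  have h0 := hε.abs_defect_sub_le (ω := ω) hw hB hN hκB hκ₀ hκ hγ hω s hy (z := 0) (by simp [mean])
    hyε (fun i => by simpa using by positivity) (fun i => by simpa using hyε i) i
  have hd := hε.half_le_speed hw hB hN hκ₀ hκ hγ hω (X := fun j => s + (0 : Fin N → ℝ) j) (s := s)
    (fun i => by simpa using by positivity)
  -- On the diagonal only the spread of the frequencies contributes.
  have h1 : |defect P R κ κ₀ ω s 0 i| ≤ 4 / c * ε ^ 2 := by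
    have hω' : |mean ω - 1| ≤ γ := by
      rw [← mean_const hN 1]; exact abs_mean_sub_le hN hω
    have hn : field P R κ ω (fun j => s + (0 : Fin N → ℝ) j) i -
        mean (field P R κ ω fun j => s + (0 : Fin N → ℝ) j) = ω i - mean ω := by
      rw [mean_field, field_apply]
      simp only [Pi.zero_apply, add_zero, mean_const hN]
      ring
    have hωi := hω i
    unfold defect
    rw [hn, Pi.zero_apply, mul_zero, add_zero, abs_div, abs_of_pos (a := mean _) (by linarith),
      div_le_iff₀ (by linarith)]
    calc |ω i - mean ω| ≤ 2 * ε ^ 2 := by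
          rw [abs_le] at *; constructor <;> linarith
      _ = 4 / c * ε ^ 2 * (c / 2) := by field_simp; norm_num
      _ ≤ _ := by gcongr
  have hb := mul_le_mul_of_nonneg_right hε.ball hε0.le
  have h2 := (abs_sub_abs_le_abs_sub _ _).trans h0
  calc _ ≤ W * (4 / c * ε ^ 2 + defectConst B c W * ε * (W * ε)) := by gcongr; linarith
    _ ≤ m * (ε / 4) := by linarith [hb]

lemma continuous_field (hP : Continuous P) (hR : Continuous R) : Continuous (field P R κ ω) := by
  unfold field; fun_prop

/-- The orbit of the locked solution, parametrized by the mean phase `s`. -/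
lemma IsSmall.exists_orbit (hε : IsSmall B c m W ε) (hw : IsWeight P R κ₀ c m W w)
    (hB : Bounds P R B) (hN : 1 ≤ N) (hκB : |κ| ≤ B)
    (hκ₀ : |κ₀| ≤ B) (hκ : |κ - κ₀| ≤ ε) (hγ : γ ≤ ε ^ 2) (hω : ∀ i, |ω i - 1| ≤ γ)
    (hP : Continuous P) (hR : ContDiff ℝ 1 R)
    (hPper : Function.Periodic P (2 * Real.pi)) (hRper : Function.Periodic R (2 * Real.pi)) :
    ∃ Y : ℝ → Fin N → ℝ, (∀ s, mean (Y s) = s) ∧ (∀ s i, Y (s + 2 * Real.pi) i =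
      Y s i + 2 * Real.pi) ∧ (∀ s i, |Y s i - s| ≤ ε * w s / 4) ∧
      (∀ s, 0 < mean (field P R κ ω (Y s))) ∧
      ∀ s, HasDerivAt Y ((mean (field P R κ ω (Y s)))⁻¹ • field P R κ ω (Y s)) s := by
  have hε0 := hε.pos
  have hc := hw.c_pos
  have hW := hw.one_le
  have hm := hw.m_pos
  have hwc : Continuous w := hw.contDiff.continuous
  have hL0 : 0 ≤ defectConst B c W :=
    defectConst_nonneg (by linarith [hB.one_le]) hc.le (by linarith)
  -- In the variable `u = y / w` the linear part has the constant decay rate `m`.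
  let h : ℝ → zeroMean N → zeroMean N := fun s u =>
    ⟨fun i => (w s)⁻¹ * defect P R κ κ₀ ω s (fun j => w s * u.1 j) i, by
      change mean _ = 0
      rw [mean_mul_left]
      refine mul_eq_zero_of_right _ (mean_defect hN s ?_)
      rw [mean_mul_left, show mean u.1 = 0 from u.2, mul_zero]⟩
  have hcoord : ∀ u : zeroMean N, ∀ i, |u.1 i| ≤ ‖u‖ := fun u i => norm_le_pi_norm u.1 i
  have hzero : ∀ s (u : zeroMean N), mean (fun j => w s * u.1 j) = 0 := fun s u => by
    rw [mean_mul_left, show mean u.1 = 0 from u.2, mul_zero]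
  have hwu' : ∀ s, ∀ u : zeroMean N, ‖u‖ ≤ ε / 4 → ∀ i, |w s * u.1 i| ≤ ε * w s / 4 := by
    intro s u hu i
    rw [abs_mul, abs_of_pos (hw.pos s)]
    calc _ ≤ w s * (ε / 4) := by
          have := (hcoord u i).trans hu
          have := (hw.pos s).le
          gcongr
      _ = _ := by ring
  have hwu : ∀ s, ∀ u : zeroMean N, ‖u‖ ≤ ε / 4 → ∀ i, |w s * u.1 i| ≤ W * ε := by
    intro s u hu i
    refine (hwu' s u hu i).trans ?_
    have := mul_le_mul_of_nonneg_left (hw.le s) hε0.le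
    have := mul_pos hε0 (hw.pos s)
    linarith
  have hpos : ∀ s, ∀ u : zeroMean N, ‖u‖ ≤ ε / 4 →
      0 < mean (field P R κ ω fun j => s + w s * u.1 j) := fun s u hu => by
    have := hε.half_le_speed hw hB hN hκ₀ hκ hγ hω (X := fun j => s + w s * u.1 j) (s := s)
      fun i => by simpa using hwu s u hu i
    linarith
  obtain ⟨u, huper, hule, hud⟩ := exists_periodic_solution (T := 2 * Real.pi) (m := m)
    (ρ := ε / 4) (L := defectConst B c W * ε) (by positivity) hm (by positivity)
    (h := h)
    (by
      rw [Topology.IsInducing.subtypeVal.continuousOn_iff]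
      refine continuousOn_pi.2 fun i => ?_
      have hX : Continuous fun p : ℝ × zeroMean N => fun j : Fin N => p.1 + w p.1 * p.2.1 j := by
        have : Continuous fun p : ℝ × zeroMean N => p.2.1 := continuous_subtype_val.comp continuous_snd
        exact continuous_pi fun j => continuous_fst.add
          ((hwc.comp continuous_fst).mul ((continuous_apply j).comp this))
      have hF : Continuous fun p : ℝ × zeroMean N => field P R κ ω fun j => p.1 + w p.1 * p.2.1 j :=
        (continuous_field hP hR.continuous).comp hX
      have hM := continuous_mean.comp hF
      have hdR : Continuous (deriv R) := hR.continuous_deriv le_rfl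
      have hRc := hR.continuous
      have hrate : Continuous fun s => κ₀ * P s * deriv R s / (1 - κ₀ * P s * R s) :=
        Continuous.div (by fun_prop) (by fun_prop) fun s => by linarith [hw.le_speed s]
      have hwi : Continuous fun s => (w s)⁻¹ := hwc.inv₀ fun s => (hw.pos s).ne'
      change ContinuousOn (fun p : ℝ × zeroMean N => (w p.1)⁻¹ *
        ((field P R κ ω (fun j => p.1 + w p.1 * p.2.1 j) i -
          mean (field P R κ ω fun j => p.1 + w p.1 * p.2.1 j)) /
          mean (field P R κ ω fun j => p.1 + w p.1 * p.2.1 j) +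
          κ₀ * P p.1 * deriv R p.1 / (1 - κ₀ * P p.1 * R p.1) * (w p.1 * p.2.1 i))) _
      refine (hwi.comp continuous_fst).continuousOn.mul (ContinuousOn.add
        (ContinuousOn.div (((continuous_apply i).comp hF).sub hM).continuousOn hM.continuousOn
          fun p hp => (hpos p.1 p.2 (by simpa using hp.2)).ne') ?_)
      exact ((hrate.comp continuous_fst).mul ((hwc.comp continuous_fst).mul
        ((continuous_apply i).comp (continuous_subtype_val.comp continuous_snd)))).continuousOn)
    (fun s u => by
      apply Subtype.ext
      funext i
      have hFs : field P R κ ω (fun j => s + 2 * Real.pi + w s * u.1 j) =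
          field P R κ ω (fun j => s + w s * u.1 j) := by
        have hs : ∀ j, s + 2 * Real.pi + w s * u.1 j = s + w s * u.1 j + 2 * Real.pi :=
          fun j => by ring
        funext k
        simp only [field, hs, hPper _, hRper _]
      simp only [h, hw.periodic s, defect, hFs, hPper s, hRper s, periodic_deriv hRper s])
    (fun s u hu => by
      have hu' : ‖u‖ ≤ ε / 4 := by simpa using hu
      refine (pi_norm_le_iff_of_nonneg (by positivity)).2 fun i => ?_
      change |(w s)⁻¹ * _| ≤ _
      rw [abs_mul, abs_of_pos (inv_pos.2 (hw.pos s))]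
      refine le_trans ?_ (hε.abs_defect_le hw hB hN hκB hκ₀ hκ hγ hω s (hzero s u) (hwu s u hu') i)
      gcongr
      exact hw.inv_le s)
    (fun s u hu v hv => by
      have hu' : ‖u‖ ≤ ε / 4 := by simpa using hu
      have hv' : ‖v‖ ≤ ε / 4 := by simpa using hv
      refine (pi_norm_le_iff_of_nonneg ?_).2 fun i => ?_
      · exact mul_nonneg (mul_nonneg hL0 hε0.le) (norm_nonneg _)
      change |(w s)⁻¹ * _ - (w s)⁻¹ * _| ≤ _
      have hws := hw.pos s
      rw [← mul_sub, abs_mul, abs_of_pos (inv_pos.2 hws), inv_mul_le_iff₀ hws]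
      refine (hε.abs_defect_sub_le hw hB hN hκB hκ₀ hκ hγ hω s (hzero s u) (hzero s v)
        (hwu s u hu') (hwu s v hv') (D := w s * ‖u - v‖) (fun j => ?_) i).trans
        (le_of_eq (by ring))
      rw [← mul_sub, abs_mul, abs_of_pos hws]
      gcongr
      exact hcoord (u - v) j)
    (mul_nonneg hL0 hε0.le) hε.lip
  refine ⟨fun s i => s + w s * (u s).1 i, fun s => mean_const_add hN s (hzero s (u s)),
    fun s i => ?_, fun s i => ?_, fun s => hpos s _ (hule s), fun s => hasDerivAt_pi.2 fun i => ?_⟩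
  · simp only [hw.periodic s, huper s]; ring
  · simpa using hwu' s (u s) (hule s) i
  · have hui : HasDerivAt (fun s => (u s).1 i) (-(m * (u s).1 i) + (h s (u s)).1 i) s :=
      hasDerivAt_pi.1 ((zeroMean N).subtypeL.hasFDerivAt.comp_hasDerivAt s (hud s)) i
    refine ((hasDerivAt_id s).add ((hw.hasDerivAt s).mul hui)).congr_deriv ?_
    have hws := (hw.pos s).ne'
    have hM := (hpos s _ (hule s)).ne'
    simp only [h, defect, Pi.smul_apply, smul_eq_mul]
    generalize mean (field P R κ ω fun j => s + w s * (u s).1 j) = M at *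
    generalize κ₀ * P s * deriv R s / (1 - κ₀ * P s * R s) = a at *
    field_simp
    ring

/-! ### The locked solution and its parameter region -/

/-- A global solution of the model with twice continuously differentiable `P` and `R` is `C²`. -/
lemma contDiff_of_forall_hasDerivAt (hP : ContDiff ℝ 2 P) (hR : ContDiff ℝ 2 R)
    {x : ℝ → Fin N → ℝ} (hx : ∀ t, HasDerivAt x (field P R κ ω (x t)) t) : ContDiff ℝ 2 x := by
  have hF : ContDiff ℝ 2 (field P R κ ω) := by
    refine contDiff_pi.2 fun i => ?_
    unfold field
    have : ∀ j, ContDiff ℝ 2 fun X : Fin N → ℝ => P (X j) * R (X i) := fun j =>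
      (hP.comp (contDiff_apply ℝ ℝ j)).mul (hR.comp (contDiff_apply ℝ ℝ i))
    exact contDiff_const.sub (contDiff_const.mul (contDiff_const.mul
      (ContDiff.sum fun j _ => this j)))
  have hd : Differentiable ℝ x := fun t => (hx t).differentiableAt
  have hderiv : deriv x = fun t => field P R κ ω (x t) := funext fun t => (hx t).deriv
  have h1 : ContDiff ℝ 1 x := contDiff_one_iff_deriv.2 ⟨hd, by
    rw [hderiv]; exact hF.continuous.comp hd.continuous⟩
  exact contDiff_succ_iff_deriv (n := 1).2 ⟨hd, by simp, by
    rw [hderiv]; exact (hF.of_le (by norm_num)).comp h1⟩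

/-- The locked solution `x(t) = Y(μ(t))`, where `Y` is the orbit over the mean phase and `μ` solves
the scalar equation for the mean phase along that orbit. -/
lemma IsSmall.exists_locked (hε : IsSmall B c m W ε) (hw : IsWeight P R κ₀ c m W w)
    (hB : Bounds P R B) (hN : 1 ≤ N) (hκB : |κ| ≤ B)
    (hκ₀ : |κ₀| ≤ B) (hκ : |κ - κ₀| ≤ ε) (hγ : γ ≤ ε ^ 2) (hω : ∀ i, |ω i - 1| ≤ γ)
    (hP : ContDiff ℝ 2 P) (hR : ContDiff ℝ 2 R)
    (hPper : Function.Periodic P (2 * Real.pi)) (hRper : Function.Periodic R (2 * Real.pi)) :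
    ∃ (x : ℝ → Fin N → ℝ) (Ω : ℝ) (Ψ : Fin N → ℝ → ℝ),
      IsSolution P R κ ω x ∧ x 0 ∈ tube N (fun s => ε * w s) ∧ 0 < Ω ∧
      (∀ i, ContDiff ℝ 2 (Ψ i) ∧ Function.Periodic (Ψ i) (2 * Real.pi / Ω) ∧
        ∀ t, |Ψ i t| ≤ 2 * Real.pi + 1) ∧
      ∀ i, ∀ t : ℝ, 0 ≤ t → x t i = Ω * t + Ψ i t := by
  have hpi : 0 < 2 * Real.pi := by positivity
  obtain ⟨Y, hYm, hYper, hYle, hYpos, hYd⟩ := hε.exists_orbit (ω := ω) hw hB hN hκB hκ₀ hκ hγ hω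
    hP.continuous (hR.of_le (by norm_num)) hPper hRper
  have hYc : Continuous Y := continuous_iff_continuousAt.2 fun s => (hYd s).continuousAt
  obtain ⟨μ, T, hT, hμ0, hμd, hμT, hμle⟩ := exists_rotation
    (h := fun s => mean (field P R κ ω (Y s))) hpi
    (continuous_mean.comp ((continuous_field hP.continuous hR.continuous).comp hYc))
    (fun s => by
      refine congrArg mean (funext fun k => ?_)
      simp only [field, hYper s, hPper _, hRper _]) hYpos
  set x : ℝ → Fin N → ℝ := fun t => Y (μ t) with hxdef
  have hx : ∀ t, HasDerivAt x (field P R κ ω (x t)) t := fun t => by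
    refine ((hYd (μ t)).scomp t (hμd t)).congr_deriv ?_
    rw [smul_smul, mul_inv_cancel₀ (hYpos _).ne', one_smul]
  have hx2 := contDiff_of_forall_hasDerivAt hP hR hx
  have hΩT : 2 * Real.pi / (2 * Real.pi / T) = T := by field_simp
  refine ⟨x, 2 * Real.pi / T, fun i t => x t i - 2 * Real.pi / T * t,
    fun t _ => (hx t).hasDerivWithinAt, fun i j => ?_, by positivity, fun i => ⟨?_, ?_, ?_⟩,
    fun i t _ => by ring⟩
  · have hi := hYle (μ 0) i
    have hj := hYle (μ 0) j
    have := mul_pos hε.pos (hw.pos (μ 0))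
    change |Y (μ 0) j - Y (μ 0) i| < ε * w (mean (Y (μ 0)))
    rw [hYm]
    rw [abs_le] at hi hj
    rw [abs_lt]; constructor <;> linarith
  · exact ((contDiff_apply ℝ ℝ i).comp hx2).sub (contDiff_const.mul contDiff_id)
  · rw [hΩT]
    intro t
    simp only [hxdef, hμT, hYper]
    field_simp
    ring
  · intro t
    have h1 := hμle t
    have h2 := hYle (μ t) i
    have h3 : ε * w (μ t) / 4 ≤ 1 := by
      have := mul_le_mul_of_nonneg_left (hw.le (μ t)) hε.pos.le
      linarith [hε.mul_le]
    simp only [hxdef]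
    rw [abs_le] at *
    constructor <;> linarith

end

lemma one_sub_pos_of_lt_kappaStar {P R : ℝ → ℝ} {κ : ℝ} (hκ : 0 < κ)
    (h : (κ : EReal) < kappaStar P R) (x : ℝ) : 0 < 1 - κ * P x * R x := by
  obtain ⟨_, ⟨κ', rfl, hκ', hpos⟩, hlt⟩ := lt_sSup_iff.1 h
  have hlt' : κ < κ' := EReal.coe_lt_coe_iff.1 hlt
  have := hpos x
  rcases le_total (P x * R x) 0 with h | h
  · nlinarith
  · nlinarith

lemma Bounds.exists_lt_kappaStar {P R : ℝ → ℝ} {B : ℝ} (hB : Bounds P R B) :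
    ∃ κ : ℝ, 0 < κ ∧ (κ : EReal) < kappaStar P R := by
  have hB1 := hB.one_le
  have hB0 : 0 < B := by linarith
  refine ⟨(4 * B ^ 2)⁻¹, by positivity, lt_of_lt_of_le (b := (((2 * B ^ 2)⁻¹ : ℝ) : EReal))
    (EReal.coe_lt_coe_iff.2 ?_) (le_sSup ⟨_, rfl, by positivity, fun x => ?_⟩)⟩
  · gcongr; norm_num
  · have h := abs_mul_le_mul (hB.P_le x) (hB.R_le x)
    have h' : (2 * B ^ 2)⁻¹ * (P x * R x) ≤ (2 * B ^ 2)⁻¹ * (B * B) := by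
      exact mul_le_mul_of_nonneg_left ((le_abs_self _).trans h) (by positivity)
    have : (2 * B ^ 2)⁻¹ * (B * B) = 1 / 2 := by field_simp
    rw [mul_assoc]
    linarith

/-- All couplings `κ` within `ε` of `κ₀` lie in `(0, κ_*)`, and `ε` is small compared with the
contraction of the linearized dynamics at coupling `κ₀`. The rectangle
`0 < γ < ε²`, `|κ - κ₀| < ε` then belongs to the parameter region of the theorem. -/
def IsRectangle (P R : ℝ → ℝ) (κ₀ ε : ℝ) : Prop :=
  0 < ε ∧ ε < 1 ∧ ∀ κ : ℝ, |κ - κ₀| < ε →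
    0 < κ ∧ (κ : EReal) < kappaStar P R ∧
    ∃ B c m W w, Bounds P R B ∧ IsWeight P R κ₀ c m W w ∧ IsSmall B c m W ε ∧
      |κ| ≤ B ∧ |κ₀| ≤ B

lemma exists_isRectangle {P R : ℝ → ℝ} (hP : ContDiff ℝ 2 P) (hR : ContDiff ℝ 2 R)
    (hPper : Function.Periodic P (2 * Real.pi)) (hRper : Function.Periodic R (2 * Real.pi))
    (H3 : ∀ κ : ℝ, 0 < κ → (κ : EReal) < kappaStar P R →
      0 < ∫ s in (0 : ℝ)..(2 * Real.pi), P s * deriv R s / (1 - κ * P s * R s))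
    {κ₀ : ℝ} (hκ₀ : 0 < κ₀) (hlt : (κ₀ : EReal) < kappaStar P R) :
    ∀ᶠ ε in 𝓝[>] (0 : ℝ), IsRectangle P R κ₀ ε := by
  obtain ⟨B, hB⟩ := exists_bounds hP hR hPper hRper
  obtain ⟨c, m, W, w, hw⟩ := exists_weight hP hR hPper hRper hκ₀
    (one_sub_pos_of_lt_kappaStar hκ₀ hlt) (H3 κ₀ hκ₀ hlt)
  obtain ⟨κ₁, h1, h2⟩ := EReal.lt_iff_exists_real_btwn.1 hlt
  have h1' : κ₀ < κ₁ := EReal.coe_lt_coe_iff.1 h1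
  have hB0 := hB.one_le
  filter_upwards [exists_small (B + κ₀ + 1) W hw.c_pos hw.m_pos,
    Ioo_mem_nhdsGT (show 0 < κ₀ from hκ₀), Ioo_mem_nhdsGT (show 0 < κ₁ - κ₀ by linarith)]
    with ε hε e1 e2
  refine ⟨hε.pos, by linarith [hε.le_half], fun κ hκ => ?_⟩
  rw [abs_lt] at hκ
  have hκ0 : 0 < κ := by linarith [e1.2]
  refine ⟨hκ0, lt_trans (EReal.coe_lt_coe_iff.2 (by linarith [e2.2])) h2, B + κ₀ + 1, c, m, W, w,
    hB.mono (by linarith), hw, hε, ?_, ?_⟩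
  · rw [abs_of_pos hκ0]; linarith [hε.le_half]
  · rw [abs_of_pos hκ₀]; linarith

end Winfree

theorem theorem1 (P R : ℝ → ℝ)
    (hP : ContDiff ℝ 2 P) (hR : ContDiff ℝ 2 R)
    (hPper : Function.Periodic P (2 * Real.pi)) (hRper : Function.Periodic R (2 * Real.pi))
    (H3 : ∀ κ : ℝ, 0 < κ → (κ : EReal) < Winfree.kappaStar P R →
      0 < ∫ s in (0 : ℝ)..(2 * Real.pi), P s * deriv R s / (1 - κ * P s * R s)) :
    ∃ U : Set (ℝ × ℝ), IsOpen U ∧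
      (∀ γ κ : ℝ, (γ, κ) ∈ U →
        0 < γ ∧ γ < 1 ∧ 0 < κ ∧ (κ : EReal) < Winfree.kappaStar P R) ∧
      (∀ κ : ℝ, 0 ≤ κ → (κ : EReal) ≤ Winfree.kappaStar P R → ((0 : ℝ), κ) ∈ closure U) ∧
      ∀ γ κ : ℝ, (γ, κ) ∈ U →
        ∃ (Δ : ℝ → ℝ) (M : ℝ),
          ContDiff ℝ 2 Δ ∧ Function.Periodic Δ (2 * Real.pi) ∧ (∀ s, 0 < Δ s ∧ Δ s < 1) ∧
          ∀ N : ℕ, 1 ≤ N → ∀ ω : Fin N → ℝ, (∀ i, ω i ∈ Set.Ioo (1 - γ) (1 + γ)) →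
            (IsOpen (Winfree.tube N Δ) ∧
              Winfree.IsFlowInvariant P R κ ω (Winfree.tube N Δ) ∧
              ∀ x : ℝ → Fin N → ℝ, Winfree.IsSolution P R κ ω x → x 0 ∈ Winfree.tube N Δ →
                Winfree.IsSynchronized x) ∧
            ∃ (x : ℝ → Fin N → ℝ) (Ω : ℝ) (Ψ : Fin N → ℝ → ℝ),
              Winfree.IsSolution P R κ ω x ∧ x 0 ∈ Winfree.tube N Δ ∧ 0 < Ω ∧
              Winfree.IsSynchronized x ∧
              (∀ i, ContDiff ℝ 2 (Ψ i) ∧ Function.Periodic (Ψ i) (2 * Real.pi / Ω) ∧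
                ∀ t, |Ψ i t| ≤ M) ∧
              ∀ i, ∀ t : ℝ, 0 ≤ t → x t i = Ω * t + Ψ i t := by
  open Winfree Set Filter Topology in
  refine ⟨⋃ (κ₀ : ℝ) (ε : ℝ) (_ : IsRectangle P R κ₀ ε), Ioo 0 (ε ^ 2) ×ˢ Metric.ball κ₀ ε,
    isOpen_iUnion fun κ₀ => isOpen_iUnion fun ε => isOpen_iUnion fun _ =>
      isOpen_Ioo.prod Metric.isOpen_ball, fun γ κ hU => ?_, fun κ hκ hκle => ?_, fun γ κ hU => ?_⟩
  · simp only [mem_iUnion] at hU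
    obtain ⟨κ₀, ε, ⟨hε0, hε1, h⟩, hγ, hκ⟩ := hU
    obtain ⟨h1, h2, -⟩ := h κ hκ
    exact ⟨hγ.1, hγ.2.trans (by nlinarith), h1, h2⟩
  · obtain ⟨B, hB⟩ := exists_bounds hP hR hPper hRper
    obtain ⟨κ₁, hκ₁, hκ₁lt⟩ := hB.exists_lt_kappaStar
    set U := ⋃ (κ₀ : ℝ) (ε : ℝ) (_ : IsRectangle P R κ₀ ε), Ioo 0 (ε ^ 2) ×ˢ Metric.ball κ₀ ε
    have hinner : ∀ κ₀ : ℝ, 0 < κ₀ → (κ₀ : EReal) < kappaStar P R → ((0 : ℝ), κ₀) ∈ closure U := by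
      intro κ₀ h0 hlt
      obtain ⟨ε, hε⟩ := (exists_isRectangle hP hR hPper hRper H3 h0 hlt).exists
      have hsub : Ioo 0 (ε ^ 2) ×ˢ Metric.ball κ₀ ε ⊆ U := fun p hp =>
        mem_iUnion.2 ⟨κ₀, mem_iUnion.2 ⟨ε, mem_iUnion.2 ⟨hε, hp⟩⟩⟩
      refine closure_mono hsub ?_
      rw [closure_prod_eq, closure_Ioo (by have := hε.1; positivity)]
      exact ⟨⟨le_rfl, by have := hε.1; positivity⟩, subset_closure (Metric.mem_ball_self hε.1)⟩
    -- The endpoints `0` and `κ_*` are limits of convex combinations with the interior point `κ₁`.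
    have hlim : Tendsto (fun t : ℝ => ((0 : ℝ), (1 - t) * κ + t * κ₁)) (𝓝[>] 0)
        (𝓝 ((0 : ℝ), κ)) := by
      have : Continuous fun t : ℝ => ((0 : ℝ), (1 - t) * κ + t * κ₁) := by fun_prop
      have := (this.tendsto 0).mono_left (nhdsWithin_le_nhds (s := Ioi 0))
      simpa using this
    refine isClosed_closure.mem_of_tendsto hlim ?_
    filter_upwards [Ioo_mem_nhdsGT (show (0 : ℝ) < 1 by norm_num)] with t ht
    have ht1 : 0 < 1 - t := by linarith [ht.2]
    refine hinner _ (by have := mul_pos ht.1 hκ₁; positivity) ?_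
    rcases le_or_gt κ κ₁ with h | h
    · refine lt_of_le_of_lt (EReal.coe_le_coe_iff.2 ?_) hκ₁lt
      nlinarith
    · refine lt_of_lt_of_le (EReal.coe_lt_coe_iff.2 ?_) hκle
      nlinarith [ht.1]
  · simp only [mem_iUnion] at hU
    obtain ⟨κ₀, ε, ⟨hε0, hε1, h⟩, hγ, hκ⟩ := hU
    obtain ⟨-, -, B, c, m, W, w, hB, hw, hε, hκB, hκ₀⟩ := h κ hκ
    have hκ' : |κ - κ₀| ≤ ε := le_of_lt hκ
    have hΔ1 : ∀ s, ε * w s < 1 := fun s => by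
      have := mul_le_mul_of_nonneg_left (hw.le s) hε0.le
      linarith [hε.mul_le]
    refine ⟨fun s => ε * w s, 2 * Real.pi + 1, contDiff_const.mul hw.contDiff,
      fun s => by simp only [hw.periodic s], fun s => ⟨mul_pos hε0 (hw.pos s), hΔ1 s⟩,
      fun N hN ω hω => ?_⟩
    have hω' : ∀ i, |ω i - 1| ≤ γ := fun i => abs_le.2
      ⟨by linarith [(hω i).1], by linarith [(hω i).2]⟩
    have hinv : ∀ x : ℝ → Fin N → ℝ, IsSolution P R κ ω x → x 0 ∈ tube N (fun s => ε * w s) →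
        ∀ t : ℝ, 0 ≤ t → x t ∈ tube N (fun s => ε * w s) := fun x hx hx0 t ht =>
      hε.mem_tube hw hB hN hκ₀ hκ' hγ.2.le hω' hx hx0 ht
    have hsync : ∀ x : ℝ → Fin N → ℝ, IsSolution P R κ ω x →
        x 0 ∈ tube N (fun s => ε * w s) → IsSynchronized x := fun x hx hx0 =>
      ⟨1, fun t ht i j => ((hinv x hx hx0 t ht j i).trans (hΔ1 _)).le⟩
    refine ⟨⟨isOpen_tube (continuous_const.mul hw.contDiff.continuous), fun X₀ hX₀ => ⟨?_, ?_⟩,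
      hsync⟩, ?_⟩
    · obtain ⟨K, hK⟩ := hB.lipschitz_field (ω := ω) hN hκB
      obtain ⟨x, hx0, hx⟩ := exists_global_solution hK
        (hB.norm_field_le hN hκB fun i => (hω' i).trans (by nlinarith [hγ.2])) X₀
      exact ⟨x, fun t _ => (hx t).hasDerivWithinAt, hx0⟩
    · exact fun x hx hx0 t ht => hinv x hx (hx0 ▸ hX₀) t ht
    · obtain ⟨x, Ω, Ψ, hx, hx0, hΩ, hΨ, hxΨ⟩ :=
        hε.exists_locked (ω := ω) hw hB hN hκB hκ₀ hκ' hγ.2.le hω' hP hR hPper hRper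
      exact ⟨x, Ω, Ψ, hx, hx0, hΩ, hsync x hx hx0, hΨ, hxΨ⟩
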